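/- Let $G$ be an $n$-dimensional (Hausdorff, second countable) real Lie group, $dg$ a right-invariant Haar measure on $G$, and $L^2(G)=L^2(G,dg;\mathbb R)$. Let $X_1,\dots,X_n$ be a basis of the Lie algebra of $G$, regarded as left-invariant vector fields, let $U$ be a relatively compact open neighbourhood of the identity $e$, and let $x^1,\dots,x^n\in C_c^\infty(G)$ be functions with $x^i(e)=0$ which are canonical coordinates on $U$, i.e. $\exp\big(\sum_i x^i(\tau)X_i\big)=\tau$ for $\tau\in U$. The summation convention is used. Assume: (i) $b^i$ and $a^{ij}$ are bounded measurable real functions on $G$, and for each $g$ the matrix $(a^{ij}(g))$ is symmetric and non-negative definite. (ii) For each $g\in G$, $\nu(g,\cdot)$ is a Borel measure on $G$ with $\nu(g,\{g\})=0$; $g\mapsto\nu(g,gE)$ is measurable for each Borel set $E$; and $$\sup_{g}\int_G\Big(\sum_i x^i(\tau)^2\wedge 1\Big)\,\nu(g,g\,d\tau)<\infty,\qquad \sup_g\nu(g,gU^c)<\infty .$$ (iii) There is a Lévy measure $\rho$ on $G$ (a Borel measure with $\rho(\{e\})=0$, $\int_G(\sum_i x^i(\tau)^2\wedge1)\,\rho(d\tau)<\infty$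 and $\rho(U^c)<\infty$) such that for each $g$ the measure $\nu(g,g\,\cdot)$ has a density $\lambda(g,\cdot)$ with respect to $\rho$; moreover $\sup_{\tau\in U^c}\sup_g\lambda(g,\tau)<\infty$, and there is $g'\in G$ with $\lambda(g',\tau)=\sup_g\lambda(g,\tau)$ for all $\tau\in U$. For $f\in C_c^\infty(G)$ define the Courrège–Hunt operator $$\mathcal Lf(g)=b^i(g)X_if(g)+a^{ij}(g)X_iX_jf(g)+\int_G\big[f(\tau)-f(g)-x^i(g^{-1}\tau)X_if(g)\big]\,\nu(g,d\tau),$$ and suppose that $\mathcal L$ is symmetric, i.e. $\langle\mathcal Lf_1,f_2\rangle=\langle f_1,\mathcal Lf_2\rangle$ for all $f_1,f_2\in C_c^\infty(G)$, where $\langle f,h\rangle=\int_G f(g)h(g)\,dg$. Put $\mathcal E(f_1,f_2)=-\langle\mathcal Lf_1,f_2\rangle$ for $f_1,f_2\in C_c^\infty(G)$. Then for every $f\in C_c^\infty(G)$ the integral defining $\mathcal Lf(g)$ converges absolutely for every $g$ and $\mathcal Lf\in L^2(G)$. The form $\mathcal E$ has an extension which is a Dirichlet form on $L^2(G)$, i.e.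 a densely defined, symmetric, non-negative, closed bilinear form $(\mathcal E,\mathcal D)$ such that $u\in\mathcal D$ implies $v:=(u\vee0)\wedge1\in\mathcal D$ and $\mathcal E(v,v)\le\mathcal E(u,u)$. Moreover, for all $f_1,f_2\in C_c^\infty(G)$ the Beurling–Deny representation $$\mathcal E(f_1,f_2)=\int_G a^{ij}(g)\,(X_if_1)(g)\,(X_jf_2)(g)\,dg+\frac12\int_{(G\times G)\setminus D}\big(f_1(\tau)-f_1(g)\big)\big(f_2(\tau)-f_2(g)\big)\,J(d\tau,dg)$$ holds with both integrals absolutely convergent, where $D=\{(g,g):g\in G\}$ and $J(d\tau,dg)=\nu(g,d\tau)\,dg$. -/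

import Mathlib

open MeasureTheory Set Filter Topology
open scoped Manifold ContDiff ENNReal

namespace CourregeHunt

noncomputable section

section LieGroupNotions

variable {n : ℕ} {G : Type*} [TopologicalSpace G] [ChartedSpace (EuclideanSpace ℝ (Fin n)) G]
  [Group G]

/-- `f ∈ C_c^∞(G)` (real valued). -/
structure IsTest (f : G → ℝ) : Prop where
  smooth : ContMDiff (𝓡 n) 𝓘(ℝ, ℝ) ∞ f
  compact : HasCompactSupport f

/-- The derivative `g ↦ (V f)(g)` of `f` along the left-invariant vector field determined by the
Lie algebra element `V`. -/
def leftDeriv (V : GroupLieAlgebra (𝓡 n) G) (f : G → ℝ) (g : G) : ℝ :=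
  mfderiv (𝓡 n) 𝓘(ℝ, ℝ) f g (mulInvariantVectorField (I := 𝓡 n) V g)

/-- `τ = exp V`: the integral curve through the identity of the left-invariant vector field `V`
is at `τ` at time one. -/
def IsExp (V : GroupLieAlgebra (𝓡 n) G) (τ : G) : Prop :=
  ∃ γ : ℝ → G, IsMIntegralCurve (I := 𝓡 n) γ (mulInvariantVectorField (I := 𝓡 n) V) ∧
    γ 0 = 1 ∧ γ 1 = τ

/-- `U` is a relatively compact open neighbourhood of the identity and the functions
`x 0, …, x (n-1) ∈ C_c^∞(G)` restrict to canonical coordinates (of the first kind) on `U` with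
respect to the basis `X` of the Lie algebra: they vanish at the identity, and
`exp (∑ i, x i τ • X i) = τ` on `U`. -/
structure IsCanonicalCoords (X : Module.Basis (Fin n) ℝ (GroupLieAlgebra (𝓡 n) G))
    (U : Set G) (x : Fin n → G → ℝ) : Prop where
  isOpen : IsOpen U
  one_mem : (1 : G) ∈ U
  compact_closure : IsCompact (closure U)
  test : ∀ i, IsTest (n := n) (x i)
  map_one : ∀ i, x i 1 = 0
  exp_eq : ∀ τ ∈ U, IsExp (∑ i, x i τ • X i) τ

end LieGroupNotions

section Measures

variable {n : ℕ} {G : Type*} [Group G] [MeasurableSpace G]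

/-- The measure `A ↦ ν (g, g A)`. -/
def translated (ν : G → Measure G) (g : G) : Measure G :=
  (ν g).map (fun τ => g⁻¹ * τ)

/-- The function `(∑ i, x_i(τ)²) ∧ 1`. -/
def coordWeight (x : Fin n → G → ℝ) (τ : G) : ℝ≥0∞ :=
  ENNReal.ofReal (min (∑ i, x i τ ^ 2) 1)

/-- Lévy measures on `G`, relative to the coordinate functions `x` on the neighbourhood `U`. As
the `x i` are compactly supported, finiteness outside `U` is a condition of its own. -/
structure IsLevyMeasure (U : Set G) (x : Fin n → G → ℝ) (ρ : Measure G) : Prop where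
  singleton_one : ρ {1} = 0
  lintegral_lt_top : (∫⁻ τ, coordWeight x τ ∂ρ) < ⊤
  compl_lt_top : ρ Uᶜ < ⊤

/-- Lévy kernels on `G`. -/
structure IsLevyKernel (U : Set G) (x : Fin n → G → ℝ) (ν : G → Measure G) : Prop where
  singleton_self : ∀ g, ν g {g} = 0
  measurable : ∀ E, MeasurableSet E → Measurable fun g => translated ν g E
  lintegral_lt_top : (⨆ g, ∫⁻ τ, coordWeight x τ ∂(translated ν g)) < ⊤
  compl_lt_top : (⨆ g, translated ν g Uᶜ) < ⊤

/-- The measure `J(dτ, dg) = ν(g, dτ) dg` on `G × G`; the first coordinate is `τ`. -/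
def jumpMeasure (μ : Measure G) (ν : G → Measure G) : Measure (G × G) :=
  μ.bind fun g => (ν g).map fun τ => (τ, g)

end Measures

section Operator

variable {n : ℕ} {G : Type*} [TopologicalSpace G] [ChartedSpace (EuclideanSpace ℝ (Fin n)) G]
  [Group G] [MeasurableSpace G]

/-- The standing assumptions on the characteristics `(b, a, ν)` of a Courrège-Hunt operator, where
`lam g` is the Radon-Nikodym derivative of `A ↦ ν (g, g A)` with respect to `ρ`. -/
structure IsCharacteristics (U : Set G) (x : Fin n → G → ℝ) (b : G → Fin n → ℝ)
    (a : G → Matrix (Fin n) (Fin n) ℝ) (ν : G → Measure G) (ρ : Measure G)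
    (lam : G → G → ℝ≥0∞) : Prop where
  measurable_b : ∀ i, Measurable fun g => b g i
  bounded_b : ∀ i, ∃ C : ℝ, ∀ g, |b g i| ≤ C
  measurable_a : ∀ i j, Measurable fun g => a g i j
  bounded_a : ∀ i j, ∃ C : ℝ, ∀ g, |a g i j| ≤ C
  posSemidef_a : ∀ g, (a g).PosSemidef
  levyKernel : IsLevyKernel U x ν
  levyMeasure : IsLevyMeasure U x ρ
  measurable_lam : ∀ g, Measurable (lam g)
  density : ∀ g, translated ν g = ρ.withDensity (lam g)
  sup_compl_lt_top : (⨆ τ ∈ Uᶜ, ⨆ g, lam g τ) < ⊤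
  sup_attained : ∃ g', ∀ τ ∈ U, lam g' τ = ⨆ g, lam g τ

variable (X : Module.Basis (Fin n) ℝ (GroupLieAlgebra (𝓡 n) G)) (x : Fin n → G → ℝ)
  (b : G → Fin n → ℝ) (a : G → Matrix (Fin n) (Fin n) ℝ) (ν : G → Measure G)

/-- The integrand `τ ↦ f(τ) - f(g) - x^i(g⁻¹ τ) X_i f(g)` of the jump part of the operator. -/
def compensated (f : G → ℝ) (g τ : G) : ℝ :=
  f τ - f g - ∑ i, x i (g⁻¹ * τ) * leftDeriv (X i) f g

/-- The Courrège-Hunt operator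
`L f(g) = b^i(g) X_i f(g) + a^{ij}(g) X_i X_j f(g) + ∫ [f(τ) - f(g) - x^i(g⁻¹ τ) X_i f(g)] ν(g,dτ)`.
-/
def operator (f : G → ℝ) (g : G) : ℝ :=
  ∑ i, b g i * leftDeriv (X i) f g
    + ∑ i, ∑ j, a g i j * leftDeriv (X i) (leftDeriv (X j) f) g
    + ∫ τ, compensated X x f g τ ∂(ν g)

/-- The form `E(f₁, f₂) = -⟨L f₁, f₂⟩` on `C_c^∞(G)`. -/
def energy (μ : Measure G) (f₁ f₂ : G → ℝ) : ℝ :=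
  -∫ g, operator X x b a ν f₁ g * f₂ g ∂μ

/-- `L` is symmetric on `C_c^∞(G)`: `⟨L f₁, f₂⟩ = ⟨f₁, L f₂⟩`. -/
def IsSymmetricOperator (μ : Measure G) : Prop :=
  ∀ f₁ f₂ : G → ℝ, IsTest (n := n) f₁ → IsTest (n := n) f₂ →
    ∫ g, operator X x b a ν f₁ g * f₂ g ∂μ = ∫ g, f₁ g * operator X x b a ν f₂ g ∂μ

end Operator

/-- Symmetric Dirichlet forms on the real space `L²(μ)`: densely defined, symmetric, nonnegative,
closed bilinear forms on which the unit contraction operates. -/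
structure DirichletForm {α : Type*} [MeasurableSpace α] (μ : Measure α) where
  domain : Submodule ℝ (Lp ℝ 2 μ)
  form : domain →ₗ[ℝ] domain →ₗ[ℝ] ℝ
  dense : Dense (domain : Set (Lp ℝ 2 μ))
  symm : ∀ u v, form u v = form v u
  nonneg : ∀ u, 0 ≤ form u u
  /-- The domain is complete for the norm given by `form u u + ‖u‖ ^ 2`. -/
  closed : ∀ u : ℕ → domain,
    (∀ ε > 0, ∃ N, ∀ k ≥ N, ∀ m ≥ N,
      form (u k - u m) (u k - u m) + ‖u k - u m‖ ^ 2 < ε) →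
    ∃ v : domain, Tendsto (fun k => form (u k - v) (u k - v) + ‖u k - v‖ ^ 2) atTop (𝓝 0)
  markov : ∀ u : domain, ∃ v : domain,
    ((v : Lp ℝ 2 μ) : α → ℝ) =ᵐ[μ] (fun y => min (max (((u : Lp ℝ 2 μ) : α → ℝ) y) 0) 1) ∧
      form v v ≤ form u u

end

end CourregeHunt

namespace CourregeHunt

noncomputable section

/-! Everything rests on the carré du champ identity `operator_mul`: L(fh) - f Lh - h Lf equals 2
a^{ij} X_i f X_j h plus the ν-integral of the product of the increments of f and h. Symmetry tested
against cutoffs χ_k ↑ 1 gives ∫ L(fh) dg = lim ∫ fh Lχ_k dg = 0 (`integral_operator_eq_zero`), so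
integrating the identity and using symmetry once more yields the Beurling–Deny formula.

The analytic input is that Lf is bounded and integrable, hence in L². In canonical coordinates the
compensator is the exact first-order Taylor term, so the integrand is O(∑ x_i²) on U, uniformly in
g. Away from the compact set supp f · (closure U)⁻¹ only jumps out of U contribute. There λ is
bounded and ρ finite, and right invariance of dg turns their total into a multiple of ‖f‖₁
(`lintegral_lintegral_compensated_lt_top`).

The formula shows that the form is non-negative and decreases under smooth maps φ with φ(0) = 0 and
|φ'| ≤ 1 (`energy_comp_le`). Since the form comes from an operator into L², it is closable
(`exists_closed_extension`). The unit contraction is a pointwise limit of such φ, and lower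
semicontinuity of the closure carries the Markov property to the limit. -/

theorem two_le_infty : (1 + 1 : ℕ∞ω) ≤ (∞ : ℕ∞ω) := by
  rw [one_add_one_eq_two]; exact WithTop.coe_le_coe.2 le_top

theorem three_le_infty : (3 : ℕ∞ω) ≤ (∞ : ℕ∞ω) := WithTop.coe_le_coe.2 le_top

/-! ### Stability properties of test functions. -/

section TestFunctions

variable {n : ℕ} {G : Type*} [TopologicalSpace G] [ChartedSpace (EuclideanSpace ℝ (Fin n)) G]

theorem IsTest.mdiff {f : G → ℝ} (hf : IsTest (n := n) f) : MDifferentiable (𝓡 n) 𝓘(ℝ, ℝ) f :=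
  hf.smooth.mdifferentiable (by simp)

theorem IsTest.continuous {f : G → ℝ} (hf : IsTest (n := n) f) : Continuous f :=
  hf.smooth.continuous

theorem IsTest.mul {f h : G → ℝ} (hf : IsTest (n := n) f) (hh : IsTest (n := n) h) :
    IsTest (n := n) (fun y => f y * h y) :=
  ⟨hf.smooth.mul hh.smooth, hf.compact.mul_right⟩

theorem IsTest.add {f h : G → ℝ} (hf : IsTest (n := n) f) (hh : IsTest (n := n) h) :
    IsTest (n := n) (fun y => f y + h y) :=
  ⟨hf.smooth.add hh.smooth, hf.compact.add hh.compact⟩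

theorem IsTest.const_mul {f : G → ℝ} (hf : IsTest (n := n) f) (c : ℝ) :
    IsTest (n := n) (fun y => c * f y) :=
  ⟨contMDiff_const.mul hf.smooth, hf.compact.mul_left⟩

theorem IsTest.comp {f : G → ℝ} (hf : IsTest (n := n) f) {φ : ℝ → ℝ} (hφ : ContDiff ℝ ∞ φ)
    (h0 : φ 0 = 0) : IsTest (n := n) (fun y => φ (f y)) :=
  ⟨hφ.contMDiff.comp hf.smooth, hf.compact.comp_left h0⟩

end TestFunctions

/-! ### Calculus of left-invariant derivatives, and Taylor's formula along exponentials. -/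

section Calculus

variable {n : ℕ} {G : Type*} [TopologicalSpace G] [ChartedSpace (EuclideanSpace ℝ (Fin n)) G]
  [Group G]

theorem leftDeriv_sum_smul {ι : Type*} (s : Finset ι) (c : ι → ℝ)
    (V : ι → GroupLieAlgebra (𝓡 n) G) (f : G → ℝ) (g : G) :
    leftDeriv (∑ i ∈ s, c i • V i) f g = ∑ i ∈ s, c i * leftDeriv (V i) f g := by
  unfold leftDeriv mulInvariantVectorField
  refine (congrArg (mfderiv (𝓡 n) 𝓘(ℝ, ℝ) f g) (map_sum (mfderiv (𝓡 n) (𝓡 n) (g * ·) (1 : G))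
    (fun i => c i • V i) s)).trans ?_
  refine (map_sum (mfderiv (𝓡 n) 𝓘(ℝ, ℝ) f g) _ s).trans (Finset.sum_congr rfl fun i _ => ?_)
  refine (congrArg (mfderiv (𝓡 n) 𝓘(ℝ, ℝ) f g)
    (map_smul (mfderiv (𝓡 n) (𝓡 n) (g * ·) (1 : G)) (c i) (V i))).trans ?_
  exact map_smul (mfderiv (𝓡 n) 𝓘(ℝ, ℝ) f g) (c i) _

theorem leftDeriv_mul {f h : G → ℝ} {g : G} (V : GroupLieAlgebra (𝓡 n) G)
    (hf : MDifferentiableAt (𝓡 n) 𝓘(ℝ, ℝ) f g) (hh : MDifferentiableAt (𝓡 n) 𝓘(ℝ, ℝ) h g) :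
    leftDeriv V (fun y => f y * h y) g = f g * leftDeriv V h g + h g * leftDeriv V f g := by
  unfold leftDeriv
  have := (hf.hasMFDerivAt.mul hh.hasMFDerivAt).mfderiv
  have e : (fun y => f y * h y) = f * h := rfl
  rw [e, this]
  rfl

theorem leftDeriv_add {f h : G → ℝ} {g : G} (V : GroupLieAlgebra (𝓡 n) G)
    (hf : MDifferentiableAt (𝓡 n) 𝓘(ℝ, ℝ) f g) (hh : MDifferentiableAt (𝓡 n) 𝓘(ℝ, ℝ) h g) :
    leftDeriv V (fun y => f y + h y) g = leftDeriv V f g + leftDeriv V h g := by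
  unfold leftDeriv
  have := (hf.hasMFDerivAt.add hh.hasMFDerivAt).mfderiv
  have e : (fun y => f y + h y) = f + h := rfl
  rw [e, this]
  rfl

theorem leftDeriv_const_mul {f : G → ℝ} {g : G} (V : GroupLieAlgebra (𝓡 n) G) (c : ℝ)
    (hf : MDifferentiableAt (𝓡 n) 𝓘(ℝ, ℝ) f g) :
    leftDeriv V (fun y => c * f y) g = c * leftDeriv V f g := by
  unfold leftDeriv
  have := (hf.hasMFDerivAt.const_smul c).mfderiv
  have e : (fun y => c * f y) = c • f := rfl
  rw [e, this]
  rfl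

theorem leftDeriv_comp {f : G → ℝ} {g : G} (V : GroupLieAlgebra (𝓡 n) G) {φ : ℝ → ℝ}
    (hφ : DifferentiableAt ℝ φ (f g)) (hf : MDifferentiableAt (𝓡 n) 𝓘(ℝ, ℝ) f g) :
    leftDeriv V (fun y => φ (f y)) g = deriv φ (f g) * leftDeriv V f g := by
  unfold leftDeriv
  have e : (fun y => φ (f y)) = φ ∘ f := rfl
  rw [e, mfderiv_comp g hφ.mdifferentiableAt hf, mfderiv_eq_fderiv]
  exact (fderiv_eq_deriv_mul (f := φ)).trans rfl

theorem leftDeriv_eq_zero_of_notMem_tsupport (V : GroupLieAlgebra (𝓡 n) G) {f : G → ℝ} {g : G}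
    (hg : g ∉ tsupport f) : leftDeriv V f g = 0 := by
  have h : f =ᶠ[𝓝 g] fun _ => (0 : ℝ) := notMem_tsupport_iff_eventuallyEq.1 hg
  unfold leftDeriv
  rw [h.mfderiv_eq, mfderiv_const]
  rfl

theorem leftDeriv_eq_zero_of_eventuallyEq_const (V : GroupLieAlgebra (𝓡 n) G) {f : G → ℝ} {g : G}
    {c : ℝ} (h : f =ᶠ[𝓝 g] fun _ => c) : leftDeriv V f g = 0 := by
  unfold leftDeriv
  rw [h.mfderiv_eq, mfderiv_const]
  rfl

theorem tsupport_leftDeriv_subset (V : GroupLieAlgebra (𝓡 n) G) (f : G → ℝ) :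
    tsupport (leftDeriv V f) ⊆ tsupport f :=
  closure_minimal (fun g hg => by
    by_contra h
    exact hg (leftDeriv_eq_zero_of_notMem_tsupport V h)) (isClosed_tsupport f)

theorem hasCompactSupport_leftDeriv (V : GroupLieAlgebra (𝓡 n) G) {f : G → ℝ}
    (hf : HasCompactSupport f) : HasCompactSupport (leftDeriv V f) :=
  hf.of_isClosed_subset (isClosed_tsupport _) (tsupport_leftDeriv_subset V f)

variable [LieGroup (𝓡 n) ∞ G]

variable (n G) in
theorem lieGroup_minSmoothness : LieGroup (𝓡 n) (minSmoothness ℝ 3) G :=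
  LieGroup.of_le (n := ∞) (by
    rw [minSmoothness_of_isRCLikeNormedField]; exact three_le_infty)

/-- The derivative is the fibre component of the tangent map of f composed with the section V. The
cap at 2 is enough, since no more than two derivatives are ever taken. -/
theorem contMDiff_leftDeriv (V : GroupLieAlgebra (𝓡 n) G) {f : G → ℝ} {k m : ℕ∞ω}
    (hf : ContMDiff (𝓡 n) 𝓘(ℝ, ℝ) m f) (hk : k ≤ 2) (hkm : k + 1 ≤ m) :
    ContMDiff (𝓡 n) 𝓘(ℝ, ℝ) k (leftDeriv V f) := by
  have := lieGroup_minSmoothness n G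
  have : IsManifold (𝓡 n) 1 G := IsManifold.of_le (n := ∞) (mod_cast le_top)
  have h1 : ContMDiff (𝓡 n) (𝓡 n).tangent k
      (fun g : G => (mulInvariantVectorField (I := 𝓡 n) V g : TangentBundle (𝓡 n) G)) :=
    (contMDiff_mulInvariantVectorField V).of_le (hk.trans le_minSmoothness)
  have h2 := hf.contMDiff_tangentMap hkm
  have h3 := (contMDiff_snd_tangentBundle_modelSpace (n := k) ℝ 𝓘(ℝ, ℝ)).comp (h2.comp h1)
  exact h3

theorem IsTest.mdiff_leftDeriv {f : G → ℝ} (hf : IsTest (n := n) f)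
    (V : GroupLieAlgebra (𝓡 n) G) : MDifferentiable (𝓡 n) 𝓘(ℝ, ℝ) (leftDeriv V f) :=
  (contMDiff_leftDeriv V (k := 1) hf.smooth (by norm_num) two_le_infty).mdifferentiable
    (by simp)

theorem IsTest.continuous_leftDeriv {f : G → ℝ} (hf : IsTest (n := n) f)
    (V : GroupLieAlgebra (𝓡 n) G) : Continuous (leftDeriv V f) :=
  (contMDiff_leftDeriv V (k := 0) hf.smooth (by norm_num) (mod_cast le_top)).continuous

theorem IsTest.continuous_leftDeriv_leftDeriv {f : G → ℝ} (hf : IsTest (n := n) f)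
    (V W : GroupLieAlgebra (𝓡 n) G) : Continuous (leftDeriv W (leftDeriv V f)) :=
  (contMDiff_leftDeriv W (k := 0) (m := 1)
    (contMDiff_leftDeriv V (k := 1) hf.smooth (by norm_num) two_le_infty)
    (by norm_num) (by norm_num)).continuous

theorem IsTest.leftDeriv_leftDeriv_mul {f h : G → ℝ} (hf : IsTest (n := n) f)
    (hh : IsTest (n := n) h) (V W : GroupLieAlgebra (𝓡 n) G) (g : G) :
    leftDeriv W (leftDeriv V (fun y => f y * h y)) g =
      f g * leftDeriv W (leftDeriv V h) g + h g * leftDeriv W (leftDeriv V f) g +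
        (leftDeriv W f g * leftDeriv V h g + leftDeriv V f g * leftDeriv W h g) := by
  have e : leftDeriv V (fun y => f y * h y) =
      fun y => f y * leftDeriv V h y + h y * leftDeriv V f y :=
    funext fun y => leftDeriv_mul V (hf.mdiff y) (hh.mdiff y)
  have m1 := (hf.mdiff g).mul (hh.mdiff_leftDeriv V g)
  have m2 := (hh.mdiff g).mul (hf.mdiff_leftDeriv V g)
  refine (congrArg (fun u => leftDeriv W u g) e).trans ((leftDeriv_add W m1 m2).trans ?_)
  change leftDeriv W (fun y => f y * leftDeriv V h y) g +
    leftDeriv W (fun y => h y * leftDeriv V f y) g = _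
  rw [leftDeriv_mul W (hf.mdiff g) (hh.mdiff_leftDeriv V g),
    leftDeriv_mul W (hh.mdiff g) (hf.mdiff_leftDeriv V g)]
  ring

/-- Left translates of integral curves of a left-invariant field are again integral curves. -/
theorem hasDerivAt_comp_mul_curve {V : GroupLieAlgebra (𝓡 n) G} {γ : ℝ → G}
    (hγ : IsMIntegralCurve (I := 𝓡 n) γ (mulInvariantVectorField (I := 𝓡 n) V)) {f : G → ℝ}
    (hf : MDifferentiable (𝓡 n) 𝓘(ℝ, ℝ) f) (g : G) (t : ℝ) :
    HasDerivAt (fun s => f (g * γ s)) (leftDeriv V f (g * γ t)) t := by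
  have hm : ∀ (c y : G), MDifferentiableAt (𝓡 n) (𝓡 n) (fun z : G => c * z) y := fun c y =>
    (contMDiff_mul_left (I := 𝓡 n) (n := ∞) (a := c)).mdifferentiable (by simp) y
  have h1 := ((hf (g * γ t)).hasMFDerivAt.comp (γ t) (hm g (γ t)).hasMFDerivAt).comp t (hγ t)
  suffices h : ∃ L : ℝ →L[ℝ] ℝ, HasFDerivAt (fun s => f (g * γ s)) L t ∧
      L 1 = leftDeriv V f (g * γ t) by
    obtain ⟨L, hL, h⟩ := h
    exact h ▸ hL.hasDerivAt
  refine ⟨_, h1.hasFDerivAt, ?_⟩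
  have e : (fun z : G => g * γ t * z) = (fun z => g * z) ∘ fun z => γ t * z := by
    ext z; simp [mul_assoc]
  unfold leftDeriv mulInvariantVectorField
  -- Left invariance, as the chain rule for translation by g γ(t), which is translation by γ(t)
  -- followed by translation by g.
  have h3 : mfderiv (𝓡 n) (𝓡 n) (fun z : G => g * γ t * z) 1 V =
      mfderiv (𝓡 n) (𝓡 n) (fun z : G => g * z) (γ t)
        (mfderiv (𝓡 n) (𝓡 n) (fun z : G => γ t * z) 1 V) := by
    rw [e]
    have := mfderiv_comp_apply (I := 𝓡 n) (I' := 𝓡 n) (I'' := 𝓡 n) (1 : G)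
      (g := fun z : G => g * z) (f := fun z : G => γ t * z) (hm g _) (hm (γ t) 1) V
    rwa [mul_one] at this
  rw [h3]
  change mfderiv (𝓡 n) 𝓘(ℝ, ℝ) f (g * γ t) (mfderiv (𝓡 n) (𝓡 n) (fun z : G => g * z) (γ t)
    ((1 : ℝ) • mulInvariantVectorField (I := 𝓡 n) V (γ t))) = _
  rw [one_smul]
  rfl

/-- Two mean value theorems write the remainder as u''(d) c with 0 < d < c < 1. The sharp constant
M/2 is not needed. -/
theorem abs_sub_sub_le_of_hasDerivAt {u u' u'' : ℝ → ℝ} {M : ℝ}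
    (h1 : ∀ t, HasDerivAt u (u' t) t) (h2 : ∀ t, HasDerivAt u' (u'' t) t)
    (hM : ∀ t, |u'' t| ≤ M) : |u 1 - u 0 - u' 0| ≤ M := by
  obtain ⟨c, hc, e⟩ := exists_hasDerivAt_eq_slope (fun t => u t - t * u' 0)
    (fun t => u' t - u' 0) zero_lt_one
    (fun t _ => ((h1 t).continuousAt.sub
      (continuousAt_id.mul continuousAt_const)).continuousWithinAt)
    (fun t _ => ((h1 t).sub ((hasDerivAt_id t).mul_const (u' 0))).congr_deriv (by simp))
  obtain ⟨d, hd, e'⟩ := exists_hasDerivAt_eq_slope u' u'' hc.1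
    (fun t _ => (h2 t).continuousAt.continuousWithinAt) (fun t _ => h2 t)
  have hc0 := hc.1
  have : u 1 - u 0 - u' 0 = u'' d * c := by
    have e1 : u' c - u' 0 = u 1 - u' 0 - u 0 := by simpa using e
    rw [e', sub_zero, div_mul_cancel₀ _ hc0.ne']
    linarith
  rw [this, abs_mul, abs_of_pos hc0]
  have := hM d
  have h0 := abs_nonneg (u'' d)
  nlinarith [hc.2]

theorem IsExp.abs_taylor_le {V : GroupLieAlgebra (𝓡 n) G} {τ : G} (hτ : IsExp V τ)
    {f : G → ℝ} (hf : IsTest (n := n) f) {M : ℝ}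
    (hM : ∀ g, |leftDeriv V (leftDeriv V f) g| ≤ M) (g : G) :
    |f (g * τ) - f g - leftDeriv V f g| ≤ M := by
  obtain ⟨γ, hγ, h0, h1⟩ := hτ
  have := abs_sub_sub_le_of_hasDerivAt (hasDerivAt_comp_mul_curve hγ hf.mdiff g)
    (hasDerivAt_comp_mul_curve hγ (hf.mdiff_leftDeriv V) g) (M := M) (fun t => hM _)
  simpa [h0, h1] using this

/-- Uniqueness of integral curves: those of the zero field are constant. -/
theorem IsExp.eq_one [T2Space G] {τ : G} (hτ : IsExp (0 : GroupLieAlgebra (𝓡 n) G) τ) :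
    τ = 1 := by
  have := lieGroup_minSmoothness n G
  have : IsManifold (𝓡 n) 1 G := IsManifold.of_le (n := ∞) (mod_cast le_top)
  obtain ⟨γ, hγ, h0, h1⟩ := hτ
  have hc : IsMIntegralCurve (I := 𝓡 n) (fun _ : ℝ => (1 : G))
      (mulInvariantVectorField (I := 𝓡 n) (0 : GroupLieAlgebra (𝓡 n) G)) :=
    isMIntegralCurve_const (by unfold mulInvariantVectorField; exact map_zero _)
  have := isMIntegralCurve_Ioo_eq_of_contMDiff_boundaryless (t₀ := 0)
    ((contMDiff_mulInvariantVectorField (I := 𝓡 n) (0 : GroupLieAlgebra (𝓡 n) G)).of_le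
      (le_trans (by norm_num) le_minSmoothness)) hγ hc h0
  rw [← h1, this]

end Calculus

/-! ### The weight controlling small and large jumps together. -/

section Weight

variable {n : ℕ} {G : Type*}

/-- The function `(∑ i, x_i(τ)²) ∧ 1 + 1_{Uᶜ}(τ)`, which a Lévy kernel integrates uniformly. -/
def levyWeight (U : Set G) (x : Fin n → G → ℝ) (τ : G) : ℝ≥0∞ :=
  coordWeight x τ + Uᶜ.indicator 1 τ

variable [MeasurableSpace G]

theorem measurable_coordWeight {x : Fin n → G → ℝ} (hx : ∀ i, Measurable (x i)) :
    Measurable (coordWeight x) :=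
  ENNReal.measurable_ofReal.comp
    ((Finset.measurable_sum _ fun i _ => (hx i).pow_const 2).min measurable_const)

theorem measurable_levyWeight {U : Set G} (hU : MeasurableSet U) {x : Fin n → G → ℝ}
    (hx : ∀ i, Measurable (x i)) : Measurable (levyWeight U x) :=
  (measurable_coordWeight hx).add (measurable_one.indicator hU.compl)

theorem IsLevyKernel.exists_lintegral_levyWeight_le [Group G] {U : Set G} (hU : MeasurableSet U)
    {x : Fin n → G → ℝ} (hx : ∀ i, Measurable (x i)) {ν : G → Measure G}
    (hν : IsLevyKernel U x ν) :
    ∃ A < ⊤, ∀ g, ∫⁻ τ, levyWeight U x τ ∂(translated ν g) ≤ A := by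
  refine ⟨_, ENNReal.add_lt_top.2 ⟨hν.lintegral_lt_top, hν.compl_lt_top⟩, fun g => ?_⟩
  unfold levyWeight
  rw [lintegral_add_left (measurable_coordWeight hx), lintegral_indicator_one hU.compl]
  exact add_le_add (le_iSup (fun g => ∫⁻ τ, coordWeight x τ ∂(translated ν g)) g)
    (le_iSup (fun g => translated ν g Uᶜ) g)

end Weight

/-! ### The jump kernel translated to the identity, and the jump measure. -/

section Kernel

variable {n : ℕ} {G : Type*} [Group G] [MeasurableSpace G]

/-- The kernel `g ↦ ν (g, g ·)`. -/
def IsLevyKernel.kernel {U : Set G} {x : Fin n → G → ℝ} {ν : G → Measure G}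
    (hν : IsLevyKernel U x ν) : ProbabilityTheory.Kernel G G :=
  ⟨translated ν, Measure.measurable_of_measurable_coe _ fun E hE => hν.measurable E hE⟩

theorem IsLevyKernel.kernel_apply {U : Set G} {x : Fin n → G → ℝ} {ν : G → Measure G}
    (hν : IsLevyKernel U x ν) (g : G) : hν.kernel g = translated ν g := rfl

variable [MeasurableMul G]

theorem map_mul_left_translated (ν : G → Measure G) (g : G) :
    (translated ν g).map (g * ·) = ν g := by
  unfold translated
  rw [Measure.map_map (measurable_const_mul g) (measurable_const_mul g⁻¹)]
  convert Measure.map_id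
  ext; simp

theorem integral_translated (ν : G → Measure G) (g : G) (F : G → ℝ) :
    ∫ τ, F τ ∂(ν g) = ∫ σ, F (g * σ) ∂(translated ν g) := by
  conv_lhs => rw [← map_mul_left_translated ν g]
  exact integral_map_equiv (MeasurableEquiv.mulLeft g) F

theorem integrable_translated_iff (ν : G → Measure G) (g : G) (F : G → ℝ) :
    Integrable F (ν g) ↔ Integrable (fun σ => F (g * σ)) (translated ν g) := by
  conv_lhs => rw [← map_mul_left_translated ν g]
  exact integrable_map_equiv (MeasurableEquiv.mulLeft g) F

theorem IsLevyKernel.translated_singleton_one [MeasurableSingletonClass G] {U : Set G}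
    {x : Fin n → G → ℝ} {ν : G → Measure G} (hν : IsLevyKernel U x ν) (g : G) :
    translated ν g {1} = 0 := by
  unfold translated
  rw [Measure.map_apply (measurable_const_mul g⁻¹) (measurableSet_singleton 1)]
  convert hν.singleton_self g using 2
  ext τ
  simp [eq_comm]

/-- By Markov's inequality the set where the weight is at least 1/k has mass at most kA, uniformly
in g. These sets exhaust the group up to the identity, which is a null set, so disjointing them cuts
the kernel into finite kernels. This is what makes `compProd` and Fubini available. -/
theorem IsLevyKernel.isSFiniteKernel [MeasurableSingletonClass G] {U : Set G}
    (hU : MeasurableSet U) {x : Fin n → G → ℝ} (hx : ∀ i, Measurable (x i))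
    (hpos : ∀ τ, levyWeight U x τ = 0 → τ = 1) {ν : G → Measure G} (hν : IsLevyKernel U x ν) :
    ProbabilityTheory.IsSFiniteKernel hν.kernel := by
  obtain ⟨A, hA, hAν⟩ := hν.exists_lintegral_levyWeight_le hU hx
  have hw := measurable_levyWeight hU hx
  let T : ℕ → Set G := fun k => {τ | (k : ℝ≥0∞)⁻¹ ≤ levyWeight U x τ} ∪ {1}
  have hT : ∀ k, MeasurableSet (T k) := fun k =>
    (measurableSet_le measurable_const hw).union (measurableSet_singleton 1)
  have hcov : ⋃ k, T k = univ := by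
    refine eq_univ_of_forall fun τ => mem_iUnion.2 ?_
    by_cases h : levyWeight U x τ = 0
    · exact ⟨0, Or.inr (hpos τ h)⟩
    · obtain ⟨k, hk⟩ := ENNReal.exists_inv_nat_lt h
      exact ⟨k, Or.inl hk.le⟩
  have hD : ∀ k, MeasurableSet (disjointed T k) := fun k => MeasurableSet.disjointed hT k
  refine ⟨fun k => hν.kernel.restrict (hD k), fun k => ⟨k * A, ?_, fun g => ?_⟩, ?_⟩
  · exact ENNReal.mul_lt_top (ENNReal.natCast_lt_top k) hA
  · rw [ProbabilityTheory.Kernel.restrict_apply, Measure.restrict_apply_univ, hν.kernel_apply]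
    calc translated ν g (disjointed T k) ≤ translated ν g (T k) :=
          measure_mono (disjointed_subset T k)
      _ ≤ translated ν g {τ | (k : ℝ≥0∞)⁻¹ ≤ levyWeight U x τ} + translated ν g {1} :=
          measure_union_le _ _
      _ = translated ν g {τ | (k : ℝ≥0∞)⁻¹ ≤ levyWeight U x τ} := by
          rw [hν.translated_singleton_one, add_zero]
      _ ≤ k * A := by
          -- For k = 0 the threshold is 0⁻¹ = ⊤, which the finite weight never reaches.
          rcases Nat.eq_zero_or_pos k with rfl | hk
          · have : {τ | ((0 : ℕ) : ℝ≥0∞)⁻¹ ≤ levyWeight U x τ} = ∅ := by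
              ext τ
              have : levyWeight U x τ < ⊤ := by
                unfold levyWeight coordWeight
                refine ENNReal.add_lt_top.2 ⟨ENNReal.ofReal_lt_top, ?_⟩
                by_cases h : τ ∈ Uᶜ <;> simp [h]
              simpa using this.ne
            rw [this]; simp
          · have := mul_meas_ge_le_lintegral (μ := translated ν g) hw (k : ℝ≥0∞)⁻¹
            rw [mul_comm, ← div_eq_mul_inv] at this
            have h2 := (ENNReal.div_le_iff_le_mul (Or.inl (by exact_mod_cast hk.ne'))
              (Or.inl (ENNReal.natCast_ne_top k))).1 (this.trans (hAν g))
            rwa [mul_comm]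
  · ext1 g
    rw [ProbabilityTheory.Kernel.sum_apply]
    simp only [ProbabilityTheory.Kernel.restrict_apply]
    rw [← Measure.restrict_iUnion (disjoint_disjointed T) hD, iUnion_disjointed, hcov,
      Measure.restrict_univ]

theorem IsLevyKernel.jumpMeasure_eq [MeasurableMul₂ G] {U : Set G} {x : Fin n → G → ℝ}
    {ν : G → Measure G} (hν : IsLevyKernel U x ν)
    [ProbabilityTheory.IsSFiniteKernel hν.kernel] (μ : Measure G) [SFinite μ] :
    jumpMeasure μ ν = (μ.compProd hν.kernel).map fun p => (p.1 * p.2, p.1) := by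
  have hm : Measurable fun p : G × G => (p.1 * p.2, p.1) :=
    (measurable_fst.mul measurable_snd).prodMk measurable_fst
  have key : ∀ S, MeasurableSet S → ∀ g, ((ν g).map fun τ => (τ, g)) S =
      hν.kernel g (Prod.mk g ⁻¹' ((fun p : G × G => (p.1 * p.2, p.1)) ⁻¹' S)) := by
    intro S hS g
    rw [← map_mul_left_translated ν g, Measure.map_map (by fun_prop) (by fun_prop),
      Measure.map_apply (by fun_prop) hS]
    rfl
  -- `Measure.bind` can be evaluated on sets only once this family is known to be measurable.
  have hmeas : Measurable fun g => (ν g).map fun τ => (τ, g) := by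
    refine Measure.measurable_of_measurable_coe _ fun S hS => ?_
    simp_rw [key S hS]
    exact ProbabilityTheory.Kernel.measurable_kernel_prodMk_left (hm hS)
  ext S hS
  unfold jumpMeasure
  rw [Measure.bind_apply hS hmeas.aemeasurable, Measure.map_apply hm hS,
    Measure.compProd_apply (hm hS)]
  simp_rw [key S hS]

end Kernel

/-! ### Pointwise bounds for the compensated increment. -/

section Increment

variable {n : ℕ} {G : Type*} [TopologicalSpace G] [ChartedSpace (EuclideanSpace ℝ (Fin n)) G]
  [Group G]

theorem compensated_mul_left (X : Module.Basis (Fin n) ℝ (GroupLieAlgebra (𝓡 n) G))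
    (x : Fin n → G → ℝ) (f : G → ℝ) (g σ : G) :
    compensated X x f g (g * σ) = f (g * σ) - f g - ∑ i, x i σ * leftDeriv (X i) f g := by
  simp [compensated]

theorem HasCompactSupport.exists_abs_le {u : G → ℝ} (hu : HasCompactSupport u)
    (hc : Continuous u) : ∃ C, 0 ≤ C ∧ ∀ g, |u g| ≤ C := by
  obtain ⟨C, hC⟩ := hu.exists_bound_of_continuous hc
  exact ⟨C, (norm_nonneg _).trans (hC 1), hC⟩

variable [LieGroup (𝓡 n) ∞ G] {X : Module.Basis (Fin n) ℝ (GroupLieAlgebra (𝓡 n) G)} {U : Set G}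
  {x : Fin n → G → ℝ}

theorem IsTest.leftDeriv_leftDeriv_sum_smul {f : G → ℝ} (hf : IsTest (n := n) f)
    (V : Fin n → GroupLieAlgebra (𝓡 n) G) (c : Fin n → ℝ) (g : G) :
    leftDeriv (∑ i, c i • V i) (leftDeriv (∑ i, c i • V i) f) g =
      ∑ j, ∑ i, c j * (c i * leftDeriv (V j) (leftDeriv (V i) f) g) := by
  have e : leftDeriv (∑ i, c i • V i) f = fun y => ∑ i, c i * leftDeriv (V i) f y :=
    funext fun y => leftDeriv_sum_smul _ _ _ _ _
  have hs : ∀ (W : GroupLieAlgebra (𝓡 n) G) (s : Finset (Fin n)),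
      MDifferentiableAt (𝓡 n) 𝓘(ℝ, ℝ) (fun y => ∑ i ∈ s, c i * leftDeriv (V i) f y) g ∧
      leftDeriv W (fun y => ∑ i ∈ s, c i * leftDeriv (V i) f y) g =
        ∑ i ∈ s, c i * leftDeriv W (leftDeriv (V i) f) g := by
    intro W s
    induction s using Finset.induction_on with
    | empty =>
      simp only [Finset.sum_empty]
      exact ⟨mdifferentiableAt_const,
        leftDeriv_eq_zero_of_eventuallyEq_const W (c := 0) EventuallyEq.rfl⟩
    | insert i s hi ih =>
      simp only [Finset.sum_insert hi]
      have h1 : MDifferentiableAt (𝓡 n) 𝓘(ℝ, ℝ) (fun y => c i * leftDeriv (V i) f y) g :=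
        (hf.mdiff_leftDeriv (V i) g).const_smul (c i)
      refine ⟨h1.add ih.1, ?_⟩
      rw [← ih.2, ← leftDeriv_const_mul W (c i) (hf.mdiff_leftDeriv (V i) g)]
      exact leftDeriv_add W h1 ih.1
  rw [leftDeriv_sum_smul]
  refine Finset.sum_congr rfl fun j _ => ?_
  rw [e, (hs (V j) Finset.univ).2, Finset.mul_sum]

/-- For σ = exp V with V = ∑ x_i(σ) X_i the compensator is exactly Vf(g). What is left is a
second-order Taylor remainder, bounded by sup |VVf|, and VVf is quadratic in the coordinates of σ.
-/
theorem IsCanonicalCoords.exists_taylor_bound (hx : IsCanonicalCoords X U x) {f : G → ℝ}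
    (hf : IsTest (n := n) f) : ∃ C, 0 ≤ C ∧ ∀ g, ∀ σ ∈ U,
      |compensated X x f g (g * σ)| ≤ C * ∑ i, x i σ ^ 2 := by
  have hb : ∀ p : Fin n × Fin n, ∃ C, 0 ≤ C ∧
      ∀ g, |leftDeriv (X p.1) (leftDeriv (X p.2) f) g| ≤ C := fun p =>
    HasCompactSupport.exists_abs_le
      (hasCompactSupport_leftDeriv _ (hasCompactSupport_leftDeriv _ hf.compact))
      (hf.continuous_leftDeriv_leftDeriv _ _)
  choose C hC0 hC using hb
  refine ⟨∑ j, ∑ i, C (j, i), Finset.sum_nonneg fun j _ => Finset.sum_nonneg fun i _ => hC0 _,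
    fun g σ hσ => ?_⟩
  rw [compensated_mul_left, ← leftDeriv_sum_smul]
  refine (hx.exp_eq σ hσ).abs_taylor_le hf (fun y => ?_) g
  rw [hf.leftDeriv_leftDeriv_sum_smul, Finset.sum_mul]
  refine (Finset.abs_sum_le_sum_abs _ _).trans (Finset.sum_le_sum fun j _ => ?_)
  rw [Finset.sum_mul]
  refine (Finset.abs_sum_le_sum_abs _ _).trans (Finset.sum_le_sum fun i _ => ?_)
  rw [← mul_assoc, abs_mul, mul_comm]
  have hle : ∀ k, x k σ ^ 2 ≤ ∑ i, x i σ ^ 2 := fun k =>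
    Finset.single_le_sum (f := fun i => x i σ ^ 2) (fun i _ => sq_nonneg _) (Finset.mem_univ k)
  refine mul_le_mul (hC (j, i) y) ?_ (abs_nonneg _) (hC0 _)
  rw [abs_le]
  constructor <;> nlinarith [hle i, hle j, sq_nonneg (x j σ - x i σ), sq_nonneg (x j σ + x i σ)]

theorem IsCanonicalCoords.eq_one_of_levyWeight_eq_zero [T2Space G]
    (hx : IsCanonicalCoords X U x) {τ : G} (h : levyWeight U x τ = 0) : τ = 1 := by
  unfold levyWeight coordWeight at h
  rw [add_eq_zero, ENNReal.ofReal_eq_zero] at h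
  have hU : τ ∈ U := by
    by_contra hn
    simp [hn] at h
  have h0 : ∑ i, x i τ ^ 2 ≤ 0 := by
    rcases min_le_iff.1 h.1 with h | h
    · exact h
    · norm_num at h
  have hz : ∀ i, x i τ = 0 := fun i => by
    have := Finset.single_le_sum (f := fun i => x i τ ^ 2) (fun i _ => sq_nonneg _)
      (Finset.mem_univ i)
    exact pow_eq_zero_iff two_ne_zero |>.1 (le_antisymm (this.trans h0) (sq_nonneg _))
  have := hx.exp_eq τ hU
  simp only [hz, zero_smul, Finset.sum_const_zero] at this
  exact this.eq_one

theorem IsCanonicalCoords.exists_enorm_compensated_le (hx : IsCanonicalCoords X U x) {f : G → ℝ}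
    (hf : IsTest (n := n) f) : ∃ C : ℝ≥0∞, C < ⊤ ∧ ∀ g σ,
      ‖compensated X x f g (g * σ)‖ₑ ≤ C * levyWeight U x σ := by
  obtain ⟨C, hC0, hC⟩ := hx.exists_taylor_bound hf
  have hxb : ∀ i, ∃ B, 0 ≤ B ∧ ∀ g, |x i g| ≤ B := fun i =>
    HasCompactSupport.exists_abs_le (hx.test i).compact (hx.test i).continuous
  choose B hB0 hB using hxb
  have hfb : ∀ i, ∃ M, 0 ≤ M ∧ ∀ g, |leftDeriv (X i) f g| ≤ M := fun i =>
    HasCompactSupport.exists_abs_le (hasCompactSupport_leftDeriv _ hf.compact)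
      (hf.continuous_leftDeriv _)
  choose M hM0 hM using hfb
  obtain ⟨N, hN0, hN⟩ := HasCompactSupport.exists_abs_le hf.compact hf.continuous
  -- The first summand serves the Taylor bound on U, the second the crude bound by sup norms off U.
  set K : ℝ := C * (∑ i, B i ^ 2 + 1) + (2 * N + ∑ i, B i * M i) with hK
  have hS : 0 ≤ ∑ i, B i ^ 2 := Finset.sum_nonneg fun i _ => sq_nonneg _
  have hT : 0 ≤ ∑ i, B i * M i := Finset.sum_nonneg fun i _ => mul_nonneg (hB0 i) (hM0 i)
  refine ⟨ENNReal.ofReal K, ENNReal.ofReal_lt_top, fun g σ => ?_⟩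
  by_cases hσ : σ ∈ U
  · have hr0 : 0 ≤ ∑ i, x i σ ^ 2 := Finset.sum_nonneg fun i _ => sq_nonneg _
    have hr1 : ∑ i, x i σ ^ 2 ≤ ∑ i, B i ^ 2 := Finset.sum_le_sum fun i _ =>
      sq_le_sq' (abs_le.1 (hB i σ)).1 (abs_le.1 (hB i σ)).2
    have h1 : |compensated X x f g (g * σ)| ≤ K * min (∑ i, x i σ ^ 2) 1 := by
      refine (hC g σ hσ).trans ?_
      -- The coordinates are bounded, so truncating their squared sum at 1 costs only a constant
      -- factor.
      have h2 : ∑ i, x i σ ^ 2 ≤ (∑ i, B i ^ 2 + 1) * min (∑ i, x i σ ^ 2) 1 := by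
        rcases le_total (∑ i, x i σ ^ 2) 1 with h | h
        · rw [min_eq_left h]; nlinarith
        · rw [min_eq_right h]; linarith
      have h3 : 0 ≤ min (∑ i, x i σ ^ 2) 1 := le_min hr0 zero_le_one
      have h4 := mul_le_mul_of_nonneg_left h2 hC0
      nlinarith
    have hw : levyWeight U x σ = ENNReal.ofReal (min (∑ i, x i σ ^ 2) 1) := by
      simp [levyWeight, coordWeight, hσ]
    rw [hw, ← ENNReal.ofReal_mul (by positivity), ← ofReal_norm]
    exact ENNReal.ofReal_le_ofReal h1
  · have h1 : |compensated X x f g (g * σ)| ≤ K := by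
      rw [compensated_mul_left]
      have h2 : |∑ i, x i σ * leftDeriv (X i) f g| ≤ ∑ i, B i * M i :=
        (Finset.abs_sum_le_sum_abs _ _).trans (Finset.sum_le_sum fun i _ => by
          rw [abs_mul]
          exact mul_le_mul (hB i σ) (hM i g) (abs_nonneg _) (hB0 i))
      have h3 := abs_sub (f (g * σ) - f g) (∑ i, x i σ * leftDeriv (X i) f g)
      have h4 := abs_sub (f (g * σ)) (f g)
      have h5 := hN (g * σ)
      have h6 := hN g
      have h7 : 0 ≤ C * (∑ i, B i ^ 2 + 1) := by positivity
      linarith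
    calc ‖compensated X x f g (g * σ)‖ₑ ≤ ENNReal.ofReal K := by
          rw [← ofReal_norm]; exact ENNReal.ofReal_le_ofReal h1
      _ = ENNReal.ofReal K * 1 := (mul_one _).symm
      _ ≤ _ := by
          gcongr
          simp [levyWeight, hσ]

-- Such a g lies outside the support of f, because 1 ∈ U, and no jump σ ∈ U leads from g back into
-- it.
omit [LieGroup (𝓡 n) ∞ G] in
open scoped Pointwise in
theorem enorm_compensated_le_of_notMem [IsTopologicalGroup G] (hx : IsCanonicalCoords X U x)
    {f : G → ℝ} {g σ : G} (hg : g ∉ tsupport f * (closure U)⁻¹) :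
    ‖compensated X x f g (g * σ)‖ₑ ≤ Uᶜ.indicator (fun σ => ‖f (g * σ)‖ₑ) σ := by
  have h1 : g ∉ tsupport f := fun h => hg ⟨g, h, 1, by
    simpa using subset_closure hx.one_mem, mul_one g⟩
  have h2 : compensated X x f g (g * σ) = f (g * σ) := by
    rw [compensated_mul_left, image_eq_zero_of_notMem_tsupport h1]
    simp [leftDeriv_eq_zero_of_notMem_tsupport _ h1]
  rw [h2]
  by_cases hσ : σ ∈ U
  · have h3 : g * σ ∉ tsupport f := fun h => hg ⟨g * σ, h, σ⁻¹, by
      simpa using subset_closure hσ, by simp⟩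
    simp [image_eq_zero_of_notMem_tsupport h3]
  · simp [hσ]

end Increment

/-! ### The operator maps test functions to bounded integrable functions. -/

section OperatorBounds

variable {n : ℕ} {G : Type*} [TopologicalSpace G] [ChartedSpace (EuclideanSpace ℝ (Fin n)) G]
  [Group G] [MeasurableSpace G] {X : Module.Basis (Fin n) ℝ (GroupLieAlgebra (𝓡 n) G)} {U : Set G}
  {x : Fin n → G → ℝ} {b : G → Fin n → ℝ} {a : G → Matrix (Fin n) (Fin n) ℝ} {ν : G → Measure G}
  {ρ : Measure G} {lam : G → G → ℝ≥0∞} {f : G → ℝ}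

omit [TopologicalSpace G] [ChartedSpace (EuclideanSpace ℝ (Fin n)) G] in
theorem IsCharacteristics.exists_setLIntegral_translated_le
    (hL : IsCharacteristics U x b a ν ρ lam) (hU : MeasurableSet U) :
    ∃ Λ < ⊤, ∀ g (F : G → ℝ≥0∞), Measurable F →
      ∫⁻ σ in Uᶜ, F σ ∂(translated ν g) ≤ Λ * ∫⁻ σ in Uᶜ, F σ ∂ρ := by
  refine ⟨_, hL.sup_compl_lt_top, fun g F hF => ?_⟩
  rw [hL.density g, restrict_withDensity hU.compl,
    lintegral_withDensity_eq_lintegral_mul _ (hL.measurable_lam g) hF, ← lintegral_const_mul _ hF]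
  refine setLIntegral_mono' hU.compl fun σ hσ => ?_
  simp only [Pi.mul_apply]
  gcongr
  exact (le_iSup (fun g => lam g σ) g).trans
    (le_iSup₂ (f := fun τ (_ : τ ∈ Uᶜ) => ⨆ g, lam g τ) σ hσ)

variable [LieGroup (𝓡 n) ∞ G] [BorelSpace G]

omit [LieGroup (𝓡 n) ∞ G] in
theorem IsCanonicalCoords.measurable (hx : IsCanonicalCoords X U x) (i : Fin n) :
    Measurable (x i) := (hx.test i).continuous.measurable

omit [LieGroup (𝓡 n) ∞ G] in
theorem IsCanonicalCoords.measurableSet (hx : IsCanonicalCoords X U x) : MeasurableSet U :=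
  hx.isOpen.measurableSet

variable [IsTopologicalGroup G]

omit [MeasurableSpace G] [BorelSpace G] in
theorem continuous_compensated_mul_left (hx : IsCanonicalCoords X U x)
    (hf : IsTest (n := n) f) :
    Continuous fun p : G × G => compensated X x f p.1 (p.1 * p.2) := by
  simp_rw [compensated_mul_left]
  have h1 := hf.continuous
  have h2 := fun i => (hx.test i).continuous
  have h3 := fun i => hf.continuous_leftDeriv (X i)
  exact ((h1.comp (continuous_fst.mul continuous_snd)).sub (h1.comp continuous_fst)).sub
    (continuous_finsetSum _ fun i _ =>
      ((h2 i).comp continuous_snd).mul ((h3 i).comp continuous_fst))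

variable [SecondCountableTopology G]

theorem measurable_compensated_mul_left (hx : IsCanonicalCoords X U x)
    (hf : IsTest (n := n) f) :
    Measurable fun p : G × G => compensated X x f p.1 (p.1 * p.2) :=
  (continuous_compensated_mul_left hx hf).measurable

omit [IsTopologicalGroup G] [SecondCountableTopology G] in
theorem IsCharacteristics.exists_lintegral_compensated_le (hL : IsCharacteristics U x b a ν ρ lam)
    (hx : IsCanonicalCoords X U x) (hf : IsTest (n := n) f) :
    ∃ B < ⊤, ∀ g, ∫⁻ σ, ‖compensated X x f g (g * σ)‖ₑ ∂(translated ν g) ≤ B := by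
  obtain ⟨A, hA, hAν⟩ := hL.levyKernel.exists_lintegral_levyWeight_le hx.measurableSet hx.measurable
  obtain ⟨C, hC, hCf⟩ := hx.exists_enorm_compensated_le hf
  refine ⟨C * A, ENNReal.mul_lt_top hC hA, fun g => ?_⟩
  calc _ ≤ ∫⁻ σ, C * levyWeight U x σ ∂(translated ν g) := lintegral_mono fun σ => hCf g σ
    _ = C * ∫⁻ σ, levyWeight U x σ ∂(translated ν g) :=
        lintegral_const_mul _ (measurable_levyWeight hx.measurableSet hx.measurable)
    _ ≤ C * A := by gcongr; exact hAν g

theorem IsCharacteristics.integrable_compensated_mul_left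
    (hL : IsCharacteristics U x b a ν ρ lam) (hx : IsCanonicalCoords X U x)
    (hf : IsTest (n := n) f) (g : G) :
    Integrable (fun σ => compensated X x f g (g * σ)) (translated ν g) := by
  obtain ⟨B, hB, h⟩ := hL.exists_lintegral_compensated_le hx hf
  exact ⟨((measurable_compensated_mul_left hx hf).comp measurable_prodMk_left).aestronglyMeasurable,
    (h g).trans_lt hB⟩

theorem IsCharacteristics.integrable_compensated (hL : IsCharacteristics U x b a ν ρ lam)
    (hx : IsCanonicalCoords X U x) (hf : IsTest (n := n) f) (g : G) :
    Integrable (compensated X x f g) (ν g) :=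
  (integrable_translated_iff ν g _).2 (hL.integrable_compensated_mul_left hx hf g)

theorem IsCharacteristics.isSFiniteKernel [T2Space G] (hL : IsCharacteristics U x b a ν ρ lam)
    (hx : IsCanonicalCoords X U x) :
    ProbabilityTheory.IsSFiniteKernel hL.levyKernel.kernel :=
  hL.levyKernel.isSFiniteKernel hx.measurableSet hx.measurable
    fun _ => hx.eq_one_of_levyWeight_eq_zero

-- On the compact closure of K the uniform bound suffices. Off K only jumps out of U count; with λ
-- bounded there, Tonelli and right invariance bound their contribution by a multiple of ρ(Uᶜ) ‖f‖₁.
open scoped Pointwise in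
theorem IsCharacteristics.lintegral_lintegral_compensated_lt_top [T2Space G]
    (hL : IsCharacteristics U x b a ν ρ lam) (hx : IsCanonicalCoords X U x)
    (hf : IsTest (n := n) f) (μ : Measure G) [μ.IsMulRightInvariant] [IsFiniteMeasureOnCompacts μ]
    [SFinite μ] :
    ∫⁻ g, ∫⁻ σ, ‖compensated X x f g (g * σ)‖ₑ ∂(translated ν g) ∂μ < ⊤ := by
  have hUm := hx.measurableSet
  obtain ⟨B, hB, hBf⟩ := hL.exists_lintegral_compensated_le hx hf
  obtain ⟨Λ, hΛ, hΛf⟩ := hL.exists_setLIntegral_translated_le hUm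
  set K : Set G := tsupport f * (closure U)⁻¹ with hK
  have hKc : IsCompact K := hf.compact.isCompact.mul hx.compact_closure.inv
  have hfm := hf.continuous.measurable
  have hFm : Measurable fun p : G × G => ‖f (p.1 * p.2)‖ₑ :=
    (hfm.comp (measurable_fst.mul measurable_snd)).enorm
  have : IsFiniteMeasure (ρ.restrict Uᶜ) :=
    ⟨by rw [Measure.restrict_apply_univ]; exact hL.levyMeasure.compl_lt_top⟩
  have hpt : ∀ g, ∫⁻ σ, ‖compensated X x f g (g * σ)‖ₑ ∂(translated ν g) ≤
      (closure K).indicator (fun _ => B) g + Λ * ∫⁻ σ in Uᶜ, ‖f (g * σ)‖ₑ ∂ρ := by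
    intro g
    by_cases hg : g ∈ K
    · rw [indicator_of_mem (subset_closure hg)]
      exact (hBf g).trans le_self_add
    · refine le_trans ?_ le_add_self
      refine le_trans (lintegral_mono fun σ => enorm_compensated_le_of_notMem hx hg) ?_
      rw [lintegral_indicator hUm.compl]
      exact hΛf g _ (hFm.comp measurable_prodMk_left)
  refine (lintegral_mono hpt).trans_lt ?_
  rw [lintegral_add_left (measurable_const.indicator isClosed_closure.measurableSet),
    lintegral_indicator_const isClosed_closure.measurableSet]
  refine ENNReal.add_lt_top.2 ⟨ENNReal.mul_lt_top hB hKc.closure.measure_lt_top, ?_⟩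
  rw [lintegral_const_mul _ (hFm.lintegral_prod_right' (ν := ρ.restrict Uᶜ)),
    lintegral_lintegral_swap hFm.aemeasurable]
  -- Right invariance: the inner integral of |f(gσ)| over g does not depend on σ.
  simp_rw [lintegral_mul_right_eq_self (μ := μ) (fun g => ‖f g‖ₑ)]
  rw [lintegral_const]
  exact ENNReal.mul_lt_top hΛ (ENNReal.mul_lt_top
    (hf.continuous.integrable_of_hasCompactSupport hf.compact).hasFiniteIntegral
    (measure_lt_top _ _))

theorem IsCharacteristics.measurable_integral_translated [T2Space G]
    (hL : IsCharacteristics U x b a ν ρ lam) (hx : IsCanonicalCoords X U x)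
    {F : G × G → ℝ} (hF : Measurable F) :
    Measurable fun g => ∫ σ, F (g, σ) ∂(translated ν g) := by
  have := hL.isSFiniteKernel hx
  exact (hF.stronglyMeasurable.integral_kernel_prod_right'
    (κ := hL.levyKernel.kernel)).measurable

omit [LieGroup (𝓡 n) ∞ G] [SecondCountableTopology G] in
theorem operator_eq_translated (f : G → ℝ) (g : G) :
    operator X x b a ν f g = ∑ i, b g i * leftDeriv (X i) f g
      + ∑ i, ∑ j, a g i j * leftDeriv (X i) (leftDeriv (X j) f) g
      + ∫ σ, compensated X x f g (g * σ) ∂(translated ν g) := by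
  unfold operator
  rw [integral_translated]

omit [IsTopologicalGroup G] [SecondCountableTopology G] in
theorem integrable_and_bounded_mul {c u : G → ℝ} (hc : Measurable c) (hcb : ∃ C, ∀ g, |c g| ≤ C)
    (hu : Continuous u) (hus : HasCompactSupport u) (μ : Measure G) [IsFiniteMeasureOnCompacts μ] :
    Integrable (fun g => c g * u g) μ ∧ (∃ C, ∀ g, |c g * u g| ≤ C) ∧
      Measurable fun g => c g * u g := by
  obtain ⟨C, hC⟩ := hcb
  obtain ⟨M, hM0, hM⟩ := HasCompactSupport.exists_abs_le hus hu
  refine ⟨(hu.integrable_of_hasCompactSupport hus).bdd_mul hc.aestronglyMeasurable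
    (Eventually.of_forall hC), ⟨C * M, fun g => ?_⟩, hc.mul hu.measurable⟩
  rw [abs_mul]
  exact mul_le_mul (hC g) (hM g) (abs_nonneg _) ((abs_nonneg _).trans (hC g))

omit [TopologicalSpace G] [Group G] [BorelSpace G] [IsTopologicalGroup G]
  [SecondCountableTopology G] in
theorem integrable_and_bounded_sum {ι : Type*} (s : Finset ι) {u : ι → G → ℝ} {μ : Measure G}
    (h : ∀ i, Integrable (u i) μ ∧ (∃ C, ∀ g, |u i g| ≤ C) ∧ Measurable (u i)) :
    Integrable (fun g => ∑ i ∈ s, u i g) μ ∧ (∃ C, ∀ g, |∑ i ∈ s, u i g| ≤ C) ∧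
      Measurable fun g => ∑ i ∈ s, u i g := by
  refine ⟨integrable_finsetSum _ fun i _ => (h i).1, ?_,
    Finset.measurable_sum _ fun i _ => (h i).2.2⟩
  choose C hC using fun i => (h i).2.1
  exact ⟨∑ i ∈ s, C i, fun g => (Finset.abs_sum_le_sum_abs _ _).trans
    (Finset.sum_le_sum fun i _ => hC i g)⟩

theorem IsCharacteristics.integrable_and_bounded_operator [T2Space G]
    (hL : IsCharacteristics U x b a ν ρ lam) (hx : IsCanonicalCoords X U x)
    (hf : IsTest (n := n) f) (μ : Measure G) [μ.IsMulRightInvariant] [IsFiniteMeasureOnCompacts μ]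
    [SFinite μ] :
    Integrable (operator X x b a ν f) μ ∧ (∃ C, ∀ g, |operator X x b a ν f g| ≤ C) ∧
      Measurable (operator X x b a ν f) := by
  have h1 := integrable_and_bounded_sum Finset.univ fun i =>
    integrable_and_bounded_mul (hL.measurable_b i) (hL.bounded_b i)
      (hf.continuous_leftDeriv (X i)) (hasCompactSupport_leftDeriv _ hf.compact) μ
  have h2 := integrable_and_bounded_sum Finset.univ fun i =>
    integrable_and_bounded_sum Finset.univ fun j =>
      integrable_and_bounded_mul (hL.measurable_a i j) (hL.bounded_a i j)
        (hf.continuous_leftDeriv_leftDeriv (X j) (X i))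
        (hasCompactSupport_leftDeriv _ (hasCompactSupport_leftDeriv _ hf.compact)) μ
  have hm := hL.measurable_integral_translated hx (measurable_compensated_mul_left hx hf)
  have h3 : Integrable (fun g => ∫ σ, compensated X x f g (g * σ) ∂(translated ν g)) μ :=
    ⟨hm.aestronglyMeasurable, (lintegral_mono fun g => enorm_integral_le_lintegral_enorm _).trans_lt
      (hL.lintegral_lintegral_compensated_lt_top hx hf μ)⟩
  obtain ⟨B, hB, hBf⟩ := hL.exists_lintegral_compensated_le hx hf
  have e : operator X x b a ν f = fun g => ∑ i, b g i * leftDeriv (X i) f g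
      + ∑ i, ∑ j, a g i j * leftDeriv (X i) (leftDeriv (X j) f) g
      + ∫ σ, compensated X x f g (g * σ) ∂(translated ν g) := funext (operator_eq_translated f)
  rw [e]
  refine ⟨(h1.1.add h2.1).add h3, ?_, (h1.2.2.add h2.2.2).add hm⟩
  obtain ⟨C1, hC1⟩ := h1.2.1
  obtain ⟨C2, hC2⟩ := h2.2.1
  refine ⟨C1 + C2 + B.toReal, fun g => (abs_add_three _ _ _).trans
    (add_le_add (add_le_add (hC1 g) (hC2 g)) ?_)⟩
  have := (enorm_integral_le_lintegral_enorm _).trans (hBf g)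
  rw [← Real.norm_eq_abs, ← toReal_enorm]
  exact ENNReal.toReal_mono hB.ne this

/-- A bounded integrable function is square integrable. -/
theorem IsCharacteristics.memLp_operator [T2Space G] (hL : IsCharacteristics U x b a ν ρ lam)
    (hx : IsCanonicalCoords X U x) (hf : IsTest (n := n) f) (μ : Measure G)
    [μ.IsMulRightInvariant] [IsFiniteMeasureOnCompacts μ] [SFinite μ] :
    MemLp (operator X x b a ν f) 2 μ := by
  obtain ⟨h1, ⟨C, hC⟩, h3⟩ := hL.integrable_and_bounded_operator hx hf μ
  refine (memLp_two_iff_integrable_sq h3.aestronglyMeasurable).2 ?_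
  simp_rw [sq]
  exact h1.bdd_mul h3.aestronglyMeasurable (Eventually.of_forall hC)

end OperatorBounds

/-! ### Smooth cutoff functions. -/

section Cutoff

variable {n : ℕ} {G : Type*} [TopologicalSpace G] [ChartedSpace (EuclideanSpace ℝ (Fin n)) G]

-- Equality to 1 is required near each point of K, and not just on K, so that all derivatives of the
-- cutoff vanish there.
variable (n G) in
theorem exists_cutoff [T2Space G] [LocallyCompactSpace G] [SecondCountableTopology G]
    [IsManifold (𝓡 n) ∞ G] :
    ∃ χ : ℕ → G → ℝ, (∀ k, IsTest (n := n) (χ k)) ∧ (∀ k g, χ k g ∈ Icc 0 1) ∧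
      ∀ K : Set G, IsCompact K → ∀ᶠ k in atTop, ∀ g ∈ K, ∀ᶠ y in 𝓝 g, χ k y = 1 := by
  let E := CompactExhaustion.choice G
  have h : ∀ k, ∃ χ : C^∞⟮𝓡 n, G; 𝓘(ℝ), ℝ⟯, (∀ᶠ y in 𝓝ˢ (E k), χ y = 1) ∧
      (∀ y ∉ E (k + 1), χ y = 0) ∧ ∀ y, χ y ∈ Icc 0 1 := fun k =>
    exists_contMDiffMap_one_nhds_of_subset_interior (𝓡 n) (E.isCompact k).isClosed
      (E.subset_interior_succ k)
  choose χ h1 h0 hI using h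
  refine ⟨fun k => χ k, fun k => ⟨(χ k).contMDiff, ?_⟩, hI, fun K hK => ?_⟩
  · exact HasCompactSupport.intro (E.isCompact (k + 1)) (h0 k)
  · obtain ⟨m, hm⟩ := E.exists_superset_of_isCompact hK
    filter_upwards [eventually_ge_atTop m] with k hk g hg
    exact eventually_nhdsSet_iff_forall.1 (h1 k) g (E.subset hk (hm hg))

end Cutoff

/-! ### The carré du champ identity and the Beurling–Deny representation. -/

section BeurlingDeny

variable {n : ℕ} {G : Type*} [TopologicalSpace G] [ChartedSpace (EuclideanSpace ℝ (Fin n)) G]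
  [Group G] [MeasurableSpace G] {X : Module.Basis (Fin n) ℝ (GroupLieAlgebra (𝓡 n) G)} {U : Set G}
  {x : Fin n → G → ℝ} {b : G → Fin n → ℝ} {a : G → Matrix (Fin n) (Fin n) ℝ} {ν : G → Measure G}
  {ρ : Measure G} {lam : G → G → ℝ≥0∞} {f h : G → ℝ}
  [LieGroup (𝓡 n) ∞ G]

-- By the Leibniz rule the first-order compensators cancel, so the product of increments inherits
-- integrability from three compensated increments.
omit [MeasurableSpace G] in
omit [LieGroup (𝓡 n) ∞ G] in
theorem compensated_mul (hf : IsTest (n := n) f) (hh : IsTest (n := n) h) (g σ : G) :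
    (f (g * σ) - f g) * (h (g * σ) - h g) = compensated X x (fun y => f y * h y) g (g * σ)
      - f g * compensated X x h g (g * σ) - h g * compensated X x f g (g * σ) := by
  simp only [compensated_mul_left, leftDeriv_mul _ (hf.mdiff g) (hh.mdiff g), mul_add, mul_sub,
    Finset.sum_add_distrib, Finset.mul_sum]
  have e1 : ∀ i, x i σ * (f g * leftDeriv (X i) h g) = f g * (x i σ * leftDeriv (X i) h g) :=
    fun i => by ring
  have e2 : ∀ i, x i σ * (h g * leftDeriv (X i) f g) = h g * (x i σ * leftDeriv (X i) f g) :=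
    fun i => by ring
  simp only [e1, e2]
  ring

variable [BorelSpace G] [IsTopologicalGroup G] [SecondCountableTopology G]

theorem IsCharacteristics.integrable_increment_mul (hL : IsCharacteristics U x b a ν ρ lam)
    (hx : IsCanonicalCoords X U x) (hf : IsTest (n := n) f) (hh : IsTest (n := n) h) (g : G) :
    Integrable (fun σ => (f (g * σ) - f g) * (h (g * σ) - h g)) (translated ν g) := by
  simp_rw [compensated_mul (X := X) (x := x) hf hh]
  exact ((hL.integrable_compensated_mul_left hx (hf.mul hh) g).sub
    ((hL.integrable_compensated_mul_left hx hh g).const_mul _)).sub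
    ((hL.integrable_compensated_mul_left hx hf g).const_mul _)

theorem IsCharacteristics.operator_mul (hL : IsCharacteristics U x b a ν ρ lam)
    (hx : IsCanonicalCoords X U x) (hf : IsTest (n := n) f) (hh : IsTest (n := n) h) (g : G) :
    operator X x b a ν (fun y => f y * h y) g =
      f g * operator X x b a ν h g + h g * operator X x b a ν f g +
      2 * (∑ i, ∑ j, a g i j * leftDeriv (X i) f g * leftDeriv (X j) h g) +
      ∫ σ, (f (g * σ) - f g) * (h (g * σ) - h g) ∂(translated ν g) := by
  have hJ : ∫ σ, (f (g * σ) - f g) * (h (g * σ) - h g) ∂(translated ν g) =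
      ∫ σ, compensated X x (fun y => f y * h y) g (g * σ) ∂(translated ν g)
      - f g * ∫ σ, compensated X x h g (g * σ) ∂(translated ν g)
      - h g * ∫ σ, compensated X x f g (g * σ) ∂(translated ν g) := by
    simp_rw [compensated_mul (X := X) (x := x) hf hh]
    rw [integral_sub, integral_sub, integral_const_mul, integral_const_mul]
    · exact hL.integrable_compensated_mul_left hx (hf.mul hh) g
    · exact (hL.integrable_compensated_mul_left hx hh g).const_mul _
    · exact (hL.integrable_compensated_mul_left hx (hf.mul hh) g).sub
        ((hL.integrable_compensated_mul_left hx hh g).const_mul _)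
    · exact (hL.integrable_compensated_mul_left hx hf g).const_mul _
  have hsym : ∀ i j, a g j i = a g i j := fun i j => by
    simpa using (hL.posSemidef_a g).isHermitian.apply i j
  have hb : ∑ i, b g i * leftDeriv (X i) (fun y => f y * h y) g =
      f g * (∑ i, b g i * leftDeriv (X i) h g) + h g * ∑ i, b g i * leftDeriv (X i) f g := by
    rw [Finset.mul_sum, Finset.mul_sum, ← Finset.sum_add_distrib]
    refine Finset.sum_congr rfl fun i _ => ?_
    rw [leftDeriv_mul _ (hf.mdiff g) (hh.mdiff g)]
    ring
  have ha : ∑ i, ∑ j, a g i j * leftDeriv (X i) (leftDeriv (X j) fun y => f y * h y) g =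
      f g * (∑ i, ∑ j, a g i j * leftDeriv (X i) (leftDeriv (X j) h) g) +
      h g * (∑ i, ∑ j, a g i j * leftDeriv (X i) (leftDeriv (X j) f) g) +
      2 * ∑ i, ∑ j, a g i j * leftDeriv (X i) f g * leftDeriv (X j) h g := by
    -- Symmetry of a merges the two cross terms of the second-order Leibniz rule, whence the factor
    -- 2.
    have hswap : ∑ i, ∑ j, a g i j * leftDeriv (X j) f g * leftDeriv (X i) h g =
        ∑ i, ∑ j, a g i j * leftDeriv (X i) f g * leftDeriv (X j) h g := by
      rw [Finset.sum_comm]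
      simp_rw [hsym]
    rw [two_mul]
    nth_rw 2 [← hswap]
    simp only [Finset.mul_sum, ← Finset.sum_add_distrib]
    refine Finset.sum_congr rfl fun i _ => Finset.sum_congr rfl fun j _ => ?_
    rw [hf.leftDeriv_leftDeriv_mul hh]
    ring
  simp only [operator_eq_translated]
  rw [hJ, hb, ha]
  ring

variable [T2Space G]

-- The local terms vanish where χ is locally constant, and jumps inside U do not change the value of
-- χ.
omit [T2Space G] in
omit [LieGroup (𝓡 n) ∞ G] [SecondCountableTopology G] in
theorem IsCharacteristics.operator_eq_of_eventually_eq_one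
    (hx : IsCanonicalCoords X U x) {χ : G → ℝ} {g : G} (hg : ∀ᶠ y in 𝓝 g, χ y = 1)
    (hU : ∀ σ ∈ U, χ (g * σ) = 1) :
    operator X x b a ν χ g = ∫ σ in Uᶜ, (χ (g * σ) - 1) ∂(translated ν g) := by
  have h1 : ∀ V : GroupLieAlgebra (𝓡 n) G, leftDeriv V χ g = 0 := fun V =>
    leftDeriv_eq_zero_of_eventuallyEq_const V (c := 1) hg
  have h2 : ∀ V W : GroupLieAlgebra (𝓡 n) G, leftDeriv W (leftDeriv V χ) g = 0 := fun V W =>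
    leftDeriv_eq_zero_of_eventuallyEq_const W (c := 0) <| by
      filter_upwards [hg.eventually_nhds] with y hy
      exact leftDeriv_eq_zero_of_eventuallyEq_const V (c := 1) hy
  rw [operator_eq_translated, ← integral_indicator hx.measurableSet.compl]
  simp only [h1, h2, mul_zero, Finset.sum_const_zero, zero_add]
  congr 1
  ext σ
  rw [compensated_mul_left]
  simp only [h1, hg.self_of_nhds, mul_zero, Finset.sum_const_zero, sub_zero]
  by_cases hσ : σ ∈ U
  · simp [hσ, hU σ hσ]
  · simp [hσ]

variable [LocallyCompactSpace G] {μ : Measure G} [μ.IsMulRightInvariant]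
  [IsFiniteMeasureOnCompacts μ] [SFinite μ]

-- Dominated convergence twice: in σ over Uᶜ, which has finite mass, with bound 1; then in g with
-- bound B |h|, where B is the uniform mass of Uᶜ.
omit [LocallyCompactSpace G] in
open scoped Pointwise in
theorem IsCharacteristics.tendsto_integral_mul_operator (hL : IsCharacteristics U x b a ν ρ lam)
    (hx : IsCanonicalCoords X U x) (hh : IsTest (n := n) h) {χ : ℕ → G → ℝ}
    (hχ : ∀ k, IsTest (n := n) (χ k)) (hI : ∀ k g, χ k g ∈ Icc 0 1)
    (h1 : ∀ K : Set G, IsCompact K → ∀ᶠ k in atTop, ∀ g ∈ K, ∀ᶠ y in 𝓝 g, χ k y = 1) :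
    Tendsto (fun k => ∫ g, h g * operator X x b a ν (χ k) g ∂μ) atTop (𝓝 0) := by
  have hfin : ∀ g, translated ν g Uᶜ ≤ ⨆ g, translated ν g Uᶜ :=
    fun g => le_iSup (fun g => translated ν g Uᶜ) g
  have hlt := hL.levyKernel.compl_lt_top
  set B := ⨆ g, translated ν g Uᶜ
  have hev : ∀ᶠ k in atTop, ∀ g ∈ tsupport h, operator X x b a ν (χ k) g =
      ∫ σ in Uᶜ, (χ k (g * σ) - 1) ∂(translated ν g) := by
    -- Eventually the cutoff is 1 near supp h and on supp h · closure U, so Lχ_k reduces on supp h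
    -- to its large jumps.
    filter_upwards [h1 _ hh.compact.isCompact,
      h1 _ (hh.compact.isCompact.mul hx.compact_closure)] with k hk1 hk2 g hg
    exact operator_eq_of_eventually_eq_one hx (hk1 g hg) fun σ hσ =>
      (hk2 _ (mul_mem_mul hg (subset_closure hσ))).self_of_nhds
  have hbd : ∀ k y, ‖χ k y - 1‖ ≤ 1 := fun k y => by
    rw [Real.norm_eq_abs, abs_le]
    constructor <;> linarith [(hI k y).1, (hI k y).2]
  have hz : ∫ _ : G, (0 : ℝ) ∂μ = 0 := integral_zero _ _
  rw [← hz]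
  refine tendsto_integral_filter_of_dominated_convergence (fun g => B.toReal * ‖h g‖) ?_ ?_ ?_ ?_
  · exact Eventually.of_forall fun k => (hh.continuous.measurable.mul
      (hL.integrable_and_bounded_operator hx (hχ k) μ).2.2).aestronglyMeasurable
  · filter_upwards [hev] with k hk
    refine Eventually.of_forall fun g => ?_
    by_cases hg : g ∈ tsupport h
    · rw [hk g hg, norm_mul, mul_comm]
      refine mul_le_mul_of_nonneg_right ?_ (norm_nonneg _)
      refine (norm_setIntegral_le_of_norm_le_const ((hfin g).trans_lt hlt)
        (fun σ _ => hbd k (g * σ))).trans ?_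
      rw [one_mul]
      exact ENNReal.toReal_mono hlt.ne (hfin g)
    · simp [image_eq_zero_of_notMem_tsupport hg]
  · exact (hh.continuous.integrable_of_hasCompactSupport hh.compact).norm.const_mul _
  · refine Eventually.of_forall fun g => ?_
    by_cases hg : g ∈ tsupport h
    · have h2 : Tendsto (fun k => ∫ σ in Uᶜ, (χ k (g * σ) - 1) ∂(translated ν g)) atTop (𝓝 0) := by
        have : IsFiniteMeasure ((translated ν g).restrict Uᶜ) :=
          ⟨by rw [Measure.restrict_apply_univ]; exact (hfin g).trans_lt hlt⟩
        have hz : ∫ _ in Uᶜ, (0 : ℝ) ∂(translated ν g) = 0 := integral_zero _ _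
        rw [← hz]
        refine tendsto_integral_of_dominated_convergence (fun _ => 1) (fun k => ?_)
          (integrable_const _) (fun k => Eventually.of_forall fun σ => hbd k _)
          (Eventually.of_forall fun σ => ?_)
        · exact (((hχ k).continuous.comp (continuous_const.mul continuous_id)).sub
            continuous_const).aestronglyMeasurable
        · refine tendsto_const_nhds.congr' ?_
          filter_upwards [h1 {g * σ} isCompact_singleton] with k hk
          simp [(hk _ rfl).self_of_nhds]
      rw [← mul_zero (h g)]
      refine (h2.const_mul (h g)).congr' ?_
      filter_upwards [hev] with k hk
      rw [hk g hg]
    · simp [image_eq_zero_of_notMem_tsupport hg]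

theorem IsCharacteristics.integral_operator_eq_zero (hL : IsCharacteristics U x b a ν ρ lam)
    (hx : IsCanonicalCoords X U x) (hsymm : IsSymmetricOperator X x b a ν μ)
    (hh : IsTest (n := n) h) : ∫ g, operator X x b a ν h g ∂μ = 0 := by
  obtain ⟨χ, hχ, hI, h1⟩ := exists_cutoff n G
  obtain ⟨hi, -, hm⟩ := hL.integrable_and_bounded_operator hx hh μ
  have t1 := hL.tendsto_integral_mul_operator (μ := μ) hx hh hχ hI h1
  have t2 : Tendsto (fun k => ∫ g, operator X x b a ν h g * χ k g ∂μ) atTop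
      (𝓝 (∫ g, operator X x b a ν h g ∂μ)) := by
    refine tendsto_integral_of_dominated_convergence (fun g => ‖operator X x b a ν h g‖)
      (fun k => (hm.mul (hχ k).continuous.measurable).aestronglyMeasurable) hi.norm
      (fun k => Eventually.of_forall fun g => ?_) (Eventually.of_forall fun g => ?_)
    · rw [norm_mul]
      refine mul_le_of_le_one_right (norm_nonneg _) ?_
      rw [Real.norm_of_nonneg (hI k g).1]
      exact (hI k g).2
    · refine tendsto_const_nhds.congr' ?_
      filter_upwards [h1 {g} isCompact_singleton] with k hk
      simp [(hk _ rfl).self_of_nhds]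
  -- Symmetry moves L onto the cutoff, so the same sequence tends both to ∫ Lh and to 0.
  simp_rw [fun k => hsymm h (χ k) hh (hχ k)] at t2
  exact tendsto_nhds_unique t2 t1

omit [T2Space G] [LocallyCompactSpace G] [μ.IsMulRightInvariant] [SFinite μ] in
omit [IsTopologicalGroup G] [SecondCountableTopology G] in
theorem IsCharacteristics.integrable_diffusion (hL : IsCharacteristics U x b a ν ρ lam)
    (hf : IsTest (n := n) f) (hh : IsTest (n := n) h) :
    Integrable (fun g => ∑ i, ∑ j, a g i j * leftDeriv (X i) f g * leftDeriv (X j) h g) μ := by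
  refine integrable_finsetSum _ fun i _ => integrable_finsetSum _ fun j _ => ?_
  simp_rw [mul_assoc]
  exact (integrable_and_bounded_mul (hL.measurable_a i j) (hL.bounded_a i j)
    ((hf.continuous_leftDeriv (X i)).mul (hh.continuous_leftDeriv (X j)))
    (hasCompactSupport_leftDeriv _ hf.compact).mul_right μ).1

omit [LocallyCompactSpace G] in
theorem IsCharacteristics.integrable_mul_operator (hL : IsCharacteristics U x b a ν ρ lam)
    (hx : IsCanonicalCoords X U x) (hf : IsTest (n := n) f) (hh : IsTest (n := n) h) :
    Integrable (fun g => f g * operator X x b a ν h g) μ := by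
  obtain ⟨C, -, hC⟩ := HasCompactSupport.exists_abs_le hf.compact hf.continuous
  exact (hL.integrable_and_bounded_operator hx hh μ).1.bdd_mul
    hf.continuous.aestronglyMeasurable (Eventually.of_forall hC)

-- The carré du champ identity is solved for its jump term; every other term is known to be
-- integrable.
omit [LocallyCompactSpace G] in
theorem IsCharacteristics.integrable_integral_increment_mul
    (hL : IsCharacteristics U x b a ν ρ lam) (hx : IsCanonicalCoords X U x)
    (hf : IsTest (n := n) f) (hh : IsTest (n := n) h) :
    Integrable (fun g => ∫ σ, (f (g * σ) - f g) * (h (g * σ) - h g) ∂(translated ν g)) μ := by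
  have := (((hL.integrable_and_bounded_operator hx (hf.mul hh) μ).1.sub
    (hL.integrable_mul_operator (μ := μ) hx hf hh)).sub
    (hL.integrable_mul_operator (μ := μ) hx hh hf)).sub
    ((hL.integrable_diffusion (X := X) (μ := μ) hf hh).const_mul 2)
  refine this.congr (Eventually.of_forall fun g => ?_)
  simp only [Pi.sub_apply]
  rw [hL.operator_mul hx hf hh]
  ring

theorem IsCharacteristics.energy_eq (hL : IsCharacteristics U x b a ν ρ lam)
    (hx : IsCanonicalCoords X U x) (hsymm : IsSymmetricOperator X x b a ν μ)
    (hf : IsTest (n := n) f) (hh : IsTest (n := n) h) :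
    energy X x b a ν μ f h =
      ∫ g, ∑ i, ∑ j, a g i j * leftDeriv (X i) f g * leftDeriv (X j) h g ∂μ +
      (1 / 2) * ∫ g, ∫ σ, (f (g * σ) - f g) * (h (g * σ) - h g) ∂(translated ν g) ∂μ := by
  have h0 := hL.integral_operator_eq_zero hx hsymm (hf.mul hh)
  simp_rw [hL.operator_mul hx hf hh] at h0
  have i1 := hL.integrable_mul_operator (μ := μ) hx hf hh
  have i2 := hL.integrable_mul_operator (μ := μ) hx hh hf
  have i3 := (hL.integrable_diffusion (X := X) (μ := μ) hf hh).const_mul 2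
  have i12 : Integrable (fun g => f g * operator X x b a ν h g +
      h g * operator X x b a ν f g) μ := i1.add i2
  have i123 : Integrable (fun g => f g * operator X x b a ν h g + h g * operator X x b a ν f g +
      2 * (∑ i, ∑ j, a g i j * leftDeriv (X i) f g * leftDeriv (X j) h g)) μ := i12.add i3
  rw [integral_add i123 (hL.integrable_integral_increment_mul hx hf hh),
    integral_add i12 i3, integral_add i1 i2, integral_const_mul,
    ← hsymm f h hf hh] at h0
  unfold energy
  simp_rw [mul_comm (h _)] at h0
  linarith

-- For f = h the integrand is non-negative, so integrability of the iterated integral is enough. The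
-- mixed case follows from |AB| ≤ A² + B².
omit [LocallyCompactSpace G] in
theorem IsCharacteristics.integrable_increment_mul_compProd
    (hL : IsCharacteristics U x b a ν ρ lam) (hx : IsCanonicalCoords X U x)
    [ProbabilityTheory.IsSFiniteKernel hL.levyKernel.kernel]
    (hf : IsTest (n := n) f) (hh : IsTest (n := n) h) :
    Integrable (fun p : G × G => (f (p.1 * p.2) - f p.1) * (h (p.1 * p.2) - h p.1))
      (μ.compProd hL.levyKernel.kernel) := by
  have hc : ∀ {u v : G → ℝ}, IsTest (n := n) u → IsTest (n := n) v →
      Continuous fun p : G × G => (u (p.1 * p.2) - u p.1) * (v (p.1 * p.2) - v p.1) :=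
    fun hu hv =>
      ((hu.continuous.comp (continuous_fst.mul continuous_snd)).sub
        (hu.continuous.comp continuous_fst)).mul
      ((hv.continuous.comp (continuous_fst.mul continuous_snd)).sub
        (hv.continuous.comp continuous_fst))
  have hsq : ∀ {u : G → ℝ}, IsTest (n := n) u →
      Integrable (fun p : G × G => (u (p.1 * p.2) - u p.1) * (u (p.1 * p.2) - u p.1))
        (μ.compProd hL.levyKernel.kernel) := by
    intro u hu
    refine (Measure.integrable_compProd_iff (hc hu hu).aestronglyMeasurable).2
      ⟨Eventually.of_forall fun g => hL.integrable_increment_mul hx hu hu g, ?_⟩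
    refine (hL.integrable_integral_increment_mul hx hu hu).congr (Eventually.of_forall fun g => ?_)
    simp only [Real.norm_of_nonneg (mul_self_nonneg _)]
    rfl
  refine ((hsq hf).add (hsq hh)).mono (hc hf hh).aestronglyMeasurable
    (Eventually.of_forall fun p => ?_)
  simp only [Pi.add_apply]
  set A := f (p.1 * p.2) - f p.1
  set B := h (p.1 * p.2) - h p.1
  rw [Real.norm_eq_abs, Real.norm_of_nonneg (add_nonneg (mul_self_nonneg A) (mul_self_nonneg B)), abs_le]
  constructor <;> nlinarith [sq_nonneg (A - B), sq_nonneg (A + B)]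

theorem IsCharacteristics.beurling_deny (hL : IsCharacteristics U x b a ν ρ lam)
    (hx : IsCanonicalCoords X U x) (hsymm : IsSymmetricOperator X x b a ν μ)
    (hf : IsTest (n := n) f) (hh : IsTest (n := n) h) :
    IntegrableOn (fun p : G × G => (f p.1 - f p.2) * (h p.1 - h p.2))
        {p : G × G | p.1 ≠ p.2} (jumpMeasure μ ν) ∧
      energy X x b a ν μ f h =
        ∫ g, ∑ i, ∑ j, a g i j * leftDeriv (X i) f g * leftDeriv (X j) h g ∂μ +
        (1 / 2) * ∫ p in {p : G × G | p.1 ≠ p.2},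
          (f p.1 - f p.2) * (h p.1 - h p.2) ∂(jumpMeasure μ ν) := by
  have := hL.isSFiniteKernel hx
  have hi := hL.integrable_increment_mul_compProd (μ := μ) hx hf hh
  have hm : Measurable fun p : G × G => (p.1 * p.2, p.1) := by fun_prop
  have hF : Measurable fun p : G × G => (f p.1 - f p.2) * (h p.1 - h p.2) := by
    have := hf.continuous.measurable
    have := hh.continuous.measurable
    fun_prop
  constructor
  · refine Integrable.integrableOn ?_
    rw [hL.levyKernel.jumpMeasure_eq]
    exact (integrable_map_measure hF.aestronglyMeasurable hm.aemeasurable).2 hi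
  -- The integrand vanishes on the diagonal, so the restriction can be dropped.
  · rw [setIntegral_eq_integral_of_forall_compl_eq_zero (fun p hp => by
      have : p.1 = p.2 := by simpa using hp
      simp [this]), hL.levyKernel.jumpMeasure_eq,
      integral_map hm.aemeasurable hF.aestronglyMeasurable, Measure.integral_compProd hi]
    exact hL.energy_eq hx hsymm hf hh

end BeurlingDeny

/-! ### Closability of forms that come from operators on a Hilbert space. -/

section ClosableForms

open scoped RealInnerProductSpace

universe u

/-- K is the Hausdorff completion of V for the seminorm √B(u,u). -/
theorem exists_dense_gram_representation {V : Type u} [AddCommGroup V] [Module ℝ V]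
    (B : V →ₗ[ℝ] V →ₗ[ℝ] ℝ) (hsymm : ∀ u v, B u v = B v u) (hnonneg : ∀ u, 0 ≤ B u u) :
    ∃ (K : Type u) (_ : NormedAddCommGroup K) (_ : InnerProductSpace ℝ K) (_ : CompleteSpace K)
      (T : V →ₗ[ℝ] K), DenseRange T ∧ ∀ u v, ⟪T u, T v⟫ = B u v := by
  let c : PreInnerProductSpace.Core ℝ V :=
    { inner := fun u v => B u v
      conj_inner_symm := fun u v => hsymm v u
      re_inner_nonneg := hnonneg
      add_left := fun u v w => by simp
      smul_left := fun u v r => by simp }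
  let _ : SeminormedAddCommGroup V := InnerProductSpace.Core.toSeminormedAddCommGroup (c := c)
  let _ : InnerProductSpace ℝ V := InnerProductSpace.ofCore c
  refine ⟨UniformSpace.Completion V, inferInstance, inferInstance, inferInstance,
    (UniformSpace.Completion.toComplL (𝕜 := ℝ) (E := V) : V →ₗ[ℝ] UniformSpace.Completion V),
    UniformSpace.Completion.denseRange_coe, fun u v => ?_⟩
  exact UniformSpace.Completion.inner_coe u v

/-- Banach–Alaoglu along an ultrafilter, so no separability and no subsequence is needed. -/
theorem exists_weak_limit {K : Type*} [NormedAddCommGroup K] [InnerProductSpace ℝ K]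
    [CompleteSpace K] {y : ℕ → K} {R : ℝ} (hy : ∀ k, ‖y k‖ ≤ R) :
    ∃ (F : Filter ℕ) (w : K), F.NeBot ∧ F ≤ atTop ∧
      ∀ z, Tendsto (fun k => ⟪y k, z⟫) F (𝓝 ⟪w, z⟫) := by
  let Y : ℕ → WeakDual ℝ K := fun k =>
    StrongDual.toWeakDual (InnerProductSpace.toDual ℝ K (y k))
  have hc := WeakDual.isCompact_closedBall (𝕜 := ℝ) (0 : StrongDual ℝ K) R
  obtain ⟨ℓ, -, hℓ⟩ := isCompact_iff_ultrafilter_le_nhds.1 hc ((hyperfilter ℕ).map Y) (by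
    rw [le_principal_iff]
    refine Filter.mem_map.2 (Filter.univ_mem' fun k => ?_)
    change InnerProductSpace.toDual ℝ K (y k) ∈ Metric.closedBall (0 : StrongDual ℝ K) R
    rw [mem_closedBall_zero_iff, LinearIsometryEquiv.norm_map]
    exact hy k)
  refine ⟨hyperfilter ℕ, (InnerProductSpace.toDual ℝ K).symm (WeakDual.toStrongDual ℓ),
    inferInstance, Nat.hyperfilter_le_atTop, fun z => ?_⟩
  have h1 : Tendsto Y (hyperfilter ℕ) (𝓝 ℓ) := hℓ
  have h2 := ((WeakDual.eval_continuous z).tendsto ℓ).comp h1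
  rw [InnerProductSpace.toDual_symm_apply]
  exact h2

/-- The source of lower semicontinuity: a weak limit of the second components stays in Γ by
Hahn–Banach, and testing it against itself bounds its norm. -/
theorem exists_mem_of_tendsto_of_norm_le {H K : Type*} [NormedAddCommGroup H]
    [InnerProductSpace ℝ H] [NormedAddCommGroup K] [InnerProductSpace ℝ K] [CompleteSpace K]
    {Γ : Submodule ℝ (H × K)} (hΓ : IsClosed (Γ : Set (H × K))) {p : ℕ → H × K}
    (hp : ∀ k, p k ∈ Γ) {h : H} (hh : Tendsto (fun k => (p k).1) atTop (𝓝 h)) {r : ℕ → ℝ} {R : ℝ}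
    (hr : ∀ k, ‖(p k).2‖ ≤ r k) (hR : Tendsto r atTop (𝓝 R)) :
    ∃ w, (h, w) ∈ Γ ∧ ‖w‖ ≤ R := by
  obtain ⟨M, hM⟩ := hR.bddAbove_range
  obtain ⟨F, w, hF, hFle, hw⟩ := exists_weak_limit (y := fun k => (p k).2) (R := M)
    fun k => (hr k).trans (hM ⟨k, rfl⟩)
  refine ⟨w, ?_, ?_⟩
  · by_contra hn
    obtain ⟨f, s, hfs, hs⟩ := geometric_hahn_banach_closed_point Γ.convex hΓ hn
    have hdec : ∀ q : H × K, f q = f (q.1, 0) +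
        ⟪(InnerProductSpace.toDual ℝ K).symm (f.comp (ContinuousLinearMap.inr ℝ H K)), q.2⟫ := by
      intro q
      rw [InnerProductSpace.toDual_symm_apply]
      change f q = f (q.1, 0) + f (0, q.2)
      rw [← map_add]
      simp
    have hlim : Tendsto (fun k => f (p k)) F (𝓝 (f (h, w))) := by
      simp_rw [hdec (p _)]
      rw [hdec (h, w)]
      refine Tendsto.add ?_ ?_
      · have : Continuous fun y : H => f (y, (0 : K)) :=
          f.continuous.comp (continuous_id.prodMk continuous_const)
        exact (this.tendsto h).comp (hh.mono_left hFle)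
      · simp_rw [real_inner_comm]
        exact hw _
    exact absurd (le_of_tendsto hlim (Eventually.of_forall fun k => (hfs _ (hp k)).le))
      (not_le.2 hs)
  · have h1 : ⟪w, w⟫ ≤ R * ‖w‖ := by
      refine le_of_tendsto_of_tendsto (hw w) ((hR.mono_left hFle).mul_const ‖w‖)
        (Eventually.of_forall fun k => ?_)
      exact (real_inner_le_norm _ _).trans (mul_le_mul_of_nonneg_right (hr k) (norm_nonneg _))
    rw [real_inner_self_eq_norm_mul_norm] at h1
    by_contra hn
    rw [not_le] at hn
    have hR0 : 0 ≤ R := ge_of_tendsto hR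
      (Eventually.of_forall fun k => (norm_nonneg _).trans (hr k))
    exact absurd (le_of_mul_le_mul_right h1 (hR0.trans_lt hn)) (not_le.2 hn)

/-- A symmetric nonnegative form which comes from an operator is closable; its closure has the form
domain as a core and is lower semicontinuous. -/
theorem exists_closed_extension {V : Type u} [AddCommGroup V] [Module ℝ V] {H : Type*}
    [NormedAddCommGroup H] [InnerProductSpace ℝ H] [CompleteSpace H] (ι : V →ₗ[ℝ] H)
    (B : V →ₗ[ℝ] V →ₗ[ℝ] ℝ) (hsymm : ∀ u v, B u v = B v u) (hnonneg : ∀ u, 0 ≤ B u u)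
    (A : V → H) (hA : ∀ u v, B u v = ⟪A v, ι u⟫) :
    ∃ (D : Submodule ℝ H) (E : D →ₗ[ℝ] D →ₗ[ℝ] ℝ),
      (∀ u v, E u v = E v u) ∧ (∀ u, 0 ≤ E u u) ∧
      (∀ u : ℕ → D,
        (∀ ε > 0, ∃ N, ∀ k ≥ N, ∀ m ≥ N, E (u k - u m) (u k - u m) + ‖u k - u m‖ ^ 2 < ε) →
        ∃ v : D, Tendsto (fun k => E (u k - v) (u k - v) + ‖u k - v‖ ^ 2) atTop (𝓝 0)) ∧
      (∀ u v, ∃ u' v' : D, (u' : H) = ι u ∧ (v' : H) = ι v ∧ E u' v' = B u v) ∧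
      (∀ u : D, ∃ s : ℕ → V, Tendsto (fun k => ι (s k)) atTop (𝓝 (u : H)) ∧
        Tendsto (fun k => B (s k) (s k)) atTop (𝓝 (E u u))) ∧
      ∀ (s : ℕ → V) (h : H) (r : ℕ → ℝ) (R : ℝ), Tendsto (fun k => ι (s k)) atTop (𝓝 h) →
        (∀ k, B (s k) (s k) ≤ r k) → Tendsto r atTop (𝓝 R) →
        ∃ u : D, (u : H) = h ∧ E u u ≤ R := by
  obtain ⟨K, _, _, _, T, hT, hTB⟩ := exists_dense_gram_representation B hsymm hnonneg
  set Γ : Submodule ℝ (H × K) := (LinearMap.range (ι.prod T)).topologicalClosure with hΓdef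
  have hΓ : IsClosed (Γ : Set (H × K)) := Submodule.isClosed_topologicalClosure _
  have hmem : ∀ v, (ι v, T v) ∈ Γ := fun v => Submodule.le_topologicalClosure _ ⟨v, rfl⟩
  have hseq : ∀ p ∈ Γ, ∃ s : ℕ → V, Tendsto (fun k => ι (s k)) atTop (𝓝 p.1) ∧
      Tendsto (fun k => T (s k)) atTop (𝓝 p.2) := by
    intro p hp
    obtain ⟨q, hq, hqp⟩ := mem_closure_iff_seq_limit.1 hp
    choose s hs using hq
    refine ⟨s, ?_, ?_⟩
    · refine ((continuous_fst.tendsto p).comp hqp).congr fun k => ?_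
      simp [← hs k]
    · refine ((continuous_snd.tendsto p).comp hqp).congr fun k => ?_
      simp [← hs k]
  -- Closability: if ι s_k → 0 and T s_k → w, then ⟨w, Tv⟩ = lim B(s_k, v) = lim ⟨Av, ι s_k⟩ = 0 for
  -- all v, and T has dense range.
  have hgraph : ∀ p ∈ Γ, p.1 = 0 → p.2 = 0 := by
    intro p hp h0
    obtain ⟨s, hs1, hs2⟩ := hseq p hp
    refine hT.eq_zero_of_inner_left (𝕜 := ℝ) fun v => ?_
    have t1 : Tendsto (fun k => ⟪T (s k), T v⟫) atTop (𝓝 ⟪p.2, T v⟫) := hs2.inner tendsto_const_nhds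
    have t2 : Tendsto (fun k => ⟪T (s k), T v⟫) atTop (𝓝 ⟪A v, p.1⟫) := by
      simp_rw [hTB, hA]
      exact tendsto_const_nhds.inner hs1
    rw [h0, inner_zero_right] at t2
    exact tendsto_nhds_unique t1 t2
  let S := Γ.toLinearPMap
  have hS : ∀ u : S.domain, ((u : H), S u) ∈ Γ := fun u => Γ.mem_graph_toLinearPMap hgraph u
  have hex : ∀ p ∈ Γ, ∃ u : S.domain, (u : H) = p.1 ∧ S u = p.2 := by
    intro p hp
    refine ⟨⟨p.1, p, hp, rfl⟩, rfl, ?_⟩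
    have := Γ.sub_mem (hS ⟨p.1, p, hp, rfl⟩) hp
    exact sub_eq_zero.1 (hgraph _ this (by simp))
  -- Γ is the graph of a closed operator S, and ‖Su‖² is the closed form, so completeness of the
  -- domain is closedness of Γ.
  let E : S.domain →ₗ[ℝ] S.domain →ₗ[ℝ] ℝ := (innerₗ K).compl₁₂ S.toFun S.toFun
  have hE : ∀ u v, E u v = ⟪S u, S v⟫ := fun u v => rfl
  have hEn : ∀ u, E u u = ‖S u‖ ^ 2 := fun u => by rw [hE, real_inner_self_eq_norm_sq]
  have hBn : ∀ v, B v v = ‖T v‖ ^ 2 := fun v => by rw [← hTB, real_inner_self_eq_norm_sq]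
  refine ⟨S.domain, E, fun u v => ?_, fun u => ?_, fun u hu => ?_, fun u v => ?_, fun u => ?_,
    fun s h r R hs hr hR => ?_⟩
  · rw [hE, hE, real_inner_comm]
  · rw [hEn]; positivity
  · simp only [hEn, LinearPMap.map_sub] at hu
    have c1 : CauchySeq fun k => ((u k : S.domain) : H) := by
      refine Metric.cauchySeq_iff.2 fun ε hε => ?_
      obtain ⟨N, hN⟩ := hu (ε ^ 2) (by positivity)
      refine ⟨N, fun k hk m hm => ?_⟩
      rw [dist_eq_norm]
      refine lt_of_pow_lt_pow_left₀ 2 hε.le (lt_of_le_of_lt ?_ (hN k hk m hm))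
      exact le_add_of_nonneg_left (by positivity)
    have c2 : CauchySeq fun k => S (u k) := by
      refine Metric.cauchySeq_iff.2 fun ε hε => ?_
      obtain ⟨N, hN⟩ := hu (ε ^ 2) (by positivity)
      refine ⟨N, fun k hk m hm => ?_⟩
      rw [dist_eq_norm]
      refine lt_of_pow_lt_pow_left₀ 2 hε.le (lt_of_le_of_lt ?_ (hN k hk m hm))
      exact le_add_of_nonneg_right (by positivity)
    obtain ⟨v, hv⟩ := cauchySeq_tendsto_of_complete c1
    obtain ⟨w, hw⟩ := cauchySeq_tendsto_of_complete c2
    obtain ⟨v', rfl, rfl⟩ := hex (v, w) (hΓ.mem_of_tendsto (hv.prodMk_nhds hw)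
      (Eventually.of_forall fun k => hS (u k)))
    refine ⟨v', ?_⟩
    simp only [hEn, LinearPMap.map_sub]
    have t1 := ((tendsto_iff_norm_sub_tendsto_zero.1 hw).pow 2)
    have t2 := ((tendsto_iff_norm_sub_tendsto_zero.1 hv).pow 2)
    simpa using t1.add t2
  · obtain ⟨u', hu1, hu2⟩ := hex _ (hmem u)
    obtain ⟨v', hv1, hv2⟩ := hex _ (hmem v)
    exact ⟨u', v', hu1, hv1, by rw [hE, hu2, hv2, hTB]⟩
  · obtain ⟨s, hs1, hs2⟩ := hseq _ (hS u)
    refine ⟨s, hs1, ?_⟩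
    simp_rw [hBn, hEn]
    exact hs2.norm.pow 2
  · obtain ⟨w, hw, hwR⟩ := exists_mem_of_tendsto_of_norm_le hΓ (p := fun k => (ι (s k), T (s k)))
      (fun k => hmem _) hs (r := fun k => √(r k)) (R := √R)
      (fun k => Real.le_sqrt_of_sq_le (by rw [← hBn]; exact hr k))
      ((Real.continuous_sqrt.tendsto R).comp hR)
    obtain ⟨u, hu1, hu2⟩ := hex _ hw
    refine ⟨u, hu1, ?_⟩
    have hR0 : 0 ≤ R := ge_of_tendsto hR (Eventually.of_forall fun k => (hnonneg _).trans (hr k))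
    rw [hEn, hu2]
    calc ‖w‖ ^ 2 ≤ √R ^ 2 := by gcongr
      _ = R := Real.sq_sqrt hR0

end ClosableForms

/-! ### Smooth approximation of the unit contraction. -/

section UnitContractions

theorem hasDerivAt_softplus (c d t : ℝ) :
    HasDerivAt (fun t => Real.log (1 + Real.exp (c * (t - d))))
      (c * (1 - (1 + Real.exp (c * (t - d)))⁻¹)) t := by
  have h0 : 0 < 1 + Real.exp (c * (t - d)) := by positivity
  have h1 : HasDerivAt (fun t : ℝ => c * (t - d)) c t := by
    simpa using ((hasDerivAt_id t).sub_const d).const_mul c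
  refine ((h1.exp.const_add 1).log h0.ne').congr_deriv ?_
  field_simp
  ring

/-- The error lies between 0 and log 2 / (k + 1). -/
theorem tendsto_softplus (t : ℝ) :
    Tendsto (fun k : ℕ => Real.log (1 + Real.exp (((k : ℝ) + 1) * t)) / ((k : ℝ) + 1)) atTop
      (𝓝 (max t 0)) := by
  have hz : Tendsto (fun k : ℕ => max t 0 + Real.log 2 / ((k : ℝ) + 1)) atTop
      (𝓝 (max t 0 + 0)) := by
    refine tendsto_const_nhds.add ?_
    simpa using (tendsto_one_div_add_atTop_nhds_zero_nat (𝕜 := ℝ)).const_mul (Real.log 2) |>.congr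
      fun k => by ring
  rw [add_zero] at hz
  refine tendsto_of_tendsto_of_tendsto_of_le_of_le tendsto_const_nhds hz (fun k => ?_) fun k => ?_
  · have hk : (0 : ℝ) < (k : ℝ) + 1 := by positivity
    simp only
    rw [le_div_iff₀ hk, max_mul_of_nonneg _ _ hk.le, zero_mul, mul_comm]
    refine max_le ?_ (Real.log_nonneg (by linarith [Real.exp_pos (((k : ℝ) + 1) * t)]))
    rw [Real.le_log_iff_exp_le (by positivity)]
    linarith
  · have hk : (0 : ℝ) < (k : ℝ) + 1 := by positivity
    simp only
    have e : (max t 0 + Real.log 2 / ((k : ℝ) + 1)) * ((k : ℝ) + 1) =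
        max (((k : ℝ) + 1) * t) 0 + Real.log 2 := by
      rw [add_mul, div_mul_cancel₀ _ hk.ne', max_mul_of_nonneg _ _ hk.le, zero_mul, mul_comm]
    rw [div_le_iff₀ hk, e, Real.log_le_iff_le_exp (by positivity), Real.exp_add, Real.exp_log two_pos]
    have h1 := Real.exp_le_exp.2 (le_max_left (((k : ℝ) + 1) * t) 0)
    have h2 := Real.exp_le_exp.2 (le_max_right (((k : ℝ) + 1) * t) 0)
    rw [Real.exp_zero] at h2
    linarith

theorem exists_smooth_unit_contractions : ∃ φ : ℕ → ℝ → ℝ, (∀ k, ContDiff ℝ ∞ (φ k)) ∧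
    (∀ k, φ k 0 = 0) ∧ (∀ k t, |deriv (φ k) t| ≤ 1) ∧
    ∀ t, Tendsto (fun k => φ k t) atTop (𝓝 (min (max t 0) 1)) := by
  let s : ℕ → ℝ → ℝ → ℝ := fun k d t =>
    Real.log (1 + Real.exp (((k : ℝ) + 1) * (t - d))) / ((k : ℝ) + 1)
  have hs : ∀ k d, ContDiff ℝ ∞ (s k d) := fun k d =>
    (ContDiff.log (contDiff_const.add (Real.contDiff_exp.comp
      (contDiff_const.mul (contDiff_id.sub contDiff_const))))
      (fun t => ne_of_gt (add_pos one_pos (Real.exp_pos _)))).div_const _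
  -- This approximates t⁺ - (t - 1)⁺. Its derivative is a difference of two sigmoids, hence in [-1,
  -- 1], and the subtracted constant makes it vanish at 0.
  refine ⟨fun k t => (s k 0 t - s k 1 t) - (s k 0 0 - s k 1 0),
    fun k => ((hs k 0).sub (hs k 1)).sub contDiff_const, fun k => sub_self _, fun k t => ?_,
    fun t => ?_⟩
  · have hk : (0 : ℝ) < (k : ℝ) + 1 := by positivity
    have hd : ∀ d, HasDerivAt (s k d) (1 - (1 + Real.exp (((k : ℝ) + 1) * (t - d)))⁻¹) t :=
      fun d => ((hasDerivAt_softplus ((k : ℝ) + 1) d t).div_const _).congr_deriv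
        (mul_div_cancel_left₀ _ hk.ne')
    have h3 := (((hd 0).sub (hd 1)).sub_const (s k 0 0 - s k 1 0)).deriv
    rw [show deriv (fun t => (s k 0 t - s k 1 t) - (s k 0 0 - s k 1 0)) t = _ from h3]
    have h4 : ∀ d, 0 < (1 + Real.exp (((k : ℝ) + 1) * (t - d)))⁻¹ := fun d => by positivity
    have h5 : ∀ d, (1 + Real.exp (((k : ℝ) + 1) * (t - d)))⁻¹ ≤ 1 := fun d =>
      inv_le_one_of_one_le₀ (by linarith [Real.exp_pos (((k : ℝ) + 1) * (t - d))])
    rw [abs_le]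
    constructor <;> linarith [h4 0, h4 1, h5 0, h5 1]
  · have e : min (max t 0) 1 = (max (t - 0) 0 - max (t - 1) 0) -
        (max (0 - 0) 0 - max (0 - 1) 0) := by
      rcases le_total t 0 with h | h
      · rw [max_eq_right h, max_eq_right (by linarith : t - 0 ≤ 0),
          max_eq_right (by linarith : t - 1 ≤ 0)]
        norm_num
      · rcases le_total t 1 with h1 | h1
        · rw [max_eq_left h, max_eq_left (by linarith : 0 ≤ t - 0),
            max_eq_right (by linarith : t - 1 ≤ 0), min_eq_left h1]
          norm_num
        · rw [max_eq_left h, max_eq_left (by linarith : 0 ≤ t - 0),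
            max_eq_left (by linarith : 0 ≤ t - 1), min_eq_right h1]
          norm_num
    rw [e]
    exact ((tendsto_softplus _).sub (tendsto_softplus _)).sub
      ((tendsto_softplus _).sub (tendsto_softplus _))

theorem lipschitzWith_one_of_abs_deriv_le {φ : ℝ → ℝ} (hφ : ContDiff ℝ ∞ φ)
    (h1 : ∀ t, |deriv φ t| ≤ 1) : LipschitzWith 1 φ :=
  lipschitzWith_of_nnnorm_deriv_le (hφ.differentiable (by simp)) fun t => h1 t

theorem lipschitzWith_unit_contraction : LipschitzWith 1 fun t : ℝ => min (max t 0) 1 :=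
  (LipschitzWith.id.max_const 0).min_const 1

end UnitContractions

/-! ### Convergence of contractions acting on L². -/

section LpContractions

variable {α : Type*} [MeasurableSpace α] {μ : Measure α}

/-- Replacing w_k by u costs at most ‖w_k - u‖; then φ_k(u) → ψ(u) in L² by dominated convergence
with majorant 4u². -/
theorem tendsto_compLp {φ : ℕ → ℝ → ℝ} {ψ : ℝ → ℝ} (hφ : ∀ k, LipschitzWith 1 (φ k))
    (hφ0 : ∀ k, φ k 0 = 0) (hψ : LipschitzWith 1 ψ) (hψ0 : ψ 0 = 0)
    (hlim : ∀ t, Tendsto (fun k => φ k t) atTop (𝓝 (ψ t))) {w : ℕ → Lp ℝ 2 μ} {u : Lp ℝ 2 μ}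
    (hw : Tendsto w atTop (𝓝 u)) :
    Tendsto (fun k => (hφ k).compLp (hφ0 k) (w k)) atTop (𝓝 (hψ.compLp hψ0 u)) := by
  have h1 : Tendsto (fun k => (hφ k).compLp (hφ0 k) (w k) - (hφ k).compLp (hφ0 k) u) atTop
      (𝓝 0) := by
    refine squeeze_zero_norm (fun k => ?_) (tendsto_iff_norm_sub_tendsto_zero.1 hw)
    simpa using (hφ k).norm_compLp_sub_le (hφ0 k) (w k) u
  have h2 : Tendsto (fun k => (hφ k).compLp (hφ0 k) u - hψ.compLp hψ0 u) atTop (𝓝 0) := by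
    rw [tendsto_zero_iff_norm_tendsto_zero]
    have hsq : ∀ v : Lp ℝ 2 μ, ‖v‖ = √(∫ y, (v y) ^ 2 ∂μ) := fun v => by
      rw [eq_comm, Real.sqrt_eq_iff_eq_sq (integral_nonneg fun y => sq_nonneg _) (norm_nonneg _),
        ← real_inner_self_eq_norm_sq, L2.inner_def]
      exact integral_congr_ae (Eventually.of_forall fun y => by
        simp only [real_inner_self_eq_norm_sq, Real.norm_eq_abs, sq_abs])
    simp_rw [hsq]
    rw [← Real.sqrt_zero]
    refine (Real.continuous_sqrt.tendsto 0).comp ?_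
    have e : ∀ k, ∫ y, (((hφ k).compLp (hφ0 k) u - hψ.compLp hψ0 u : Lp ℝ 2 μ) y) ^ 2 ∂μ =
        ∫ y, (φ k (u y) - ψ (u y)) ^ 2 ∂μ := fun k => integral_congr_ae <| by
      filter_upwards [Lp.coeFn_sub ((hφ k).compLp (hφ0 k) u) (hψ.compLp hψ0 u),
        (hφ k).coeFn_compLp (hφ0 k) u, hψ.coeFn_compLp hψ0 u] with y a1 a2 a3
      rw [a1, Pi.sub_apply, a2, a3]
      rfl
    simp_rw [e]
    have hz : ∫ _ : α, (0 : ℝ) ∂μ = 0 := integral_zero _ _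
    rw [← hz]
    have hle : ∀ {θ : ℝ → ℝ}, LipschitzWith 1 θ → θ 0 = 0 → ∀ t, |θ t| ≤ |t| := by
      intro θ hθ h0 t
      simpa [h0] using hθ.dist_le_mul t 0
    refine tendsto_integral_of_dominated_convergence (fun y => 4 * (u y) ^ 2) (fun k => ?_) ?_
      (fun k => Eventually.of_forall fun y => ?_) (Eventually.of_forall fun y => ?_)
    · exact (((hφ k).continuous.comp_aestronglyMeasurable (Lp.aestronglyMeasurable u)).sub
        (hψ.continuous.comp_aestronglyMeasurable (Lp.aestronglyMeasurable u))).pow 2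
    · exact ((memLp_two_iff_integrable_sq (Lp.aestronglyMeasurable u)).1 (Lp.memLp u)).const_mul 4
    · rw [Real.norm_of_nonneg (sq_nonneg _), ← sq_abs, ← sq_abs (u y),
        show 4 * |u y| ^ 2 = (2 * |u y|) ^ 2 by ring]
      gcongr
      have a1 := hle (hφ k) (hφ0 k) (u y)
      have a2 := hle hψ hψ0 (u y)
      have a3 := abs_sub (φ k (u y)) (ψ (u y))
      linarith
    · have := ((hlim (u y)).sub_const (ψ (u y))).pow 2
      simpa using this
  have h3 := h1.add h2
  simp only [sub_add_sub_cancel, add_zero] at h3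
  exact tendsto_sub_nhds_zero_iff.1 h3

end LpContractions

/-! ### Test functions as a dense subspace of L². -/

section TestSpace

variable (n : ℕ) (G : Type*) [TopologicalSpace G] [ChartedSpace (EuclideanSpace ℝ (Fin n)) G]

/-- The space `C_c^∞(G)`. -/
def testSpace : Submodule ℝ (G → ℝ) where
  carrier := {f | IsTest (n := n) f}
  add_mem' hf hh := hf.add hh
  zero_mem' := ⟨contMDiff_const, HasCompactSupport.zero⟩
  smul_mem' c _ hf := hf.const_mul c

variable {n G}

variable [MeasurableSpace G] [BorelSpace G] (μ : Measure G) [IsFiniteMeasureOnCompacts μ]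

theorem IsTest.memLp {f : G → ℝ} (hf : IsTest (n := n) f) : MemLp f 2 μ :=
  hf.continuous.memLp_of_hasCompactSupport hf.compact

/-- The map from `C_c^∞(G)` to `L²`. -/
def testToLp : testSpace n G →ₗ[ℝ] Lp ℝ 2 μ where
  toFun f := (IsTest.memLp μ f.2).toLp f
  map_add' f h := MemLp.toLp_add (IsTest.memLp μ f.2) (IsTest.memLp μ h.2)
  map_smul' c f := MemLp.toLp_const_smul c (IsTest.memLp μ f.2)

theorem coeFn_testToLp (f : testSpace n G) : (testToLp μ f : G → ℝ) =ᵐ[μ] (f : G → ℝ) :=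
  (IsTest.memLp μ f.2).coeFn_toLp

/-- The orthogonal complement is zero by the fundamental lemma of the calculus of variations. -/
theorem dense_range_testToLp [SecondCountableTopology G] [T2Space G] [LocallyCompactSpace G] [IsManifold (𝓡 n) ∞ G] :
    Dense (LinearMap.range (testToLp (n := n) μ) : Set (Lp ℝ 2 μ)) := by
  rw [Submodule.dense_iff_topologicalClosure_eq_top, Submodule.topologicalClosure_eq_top_iff,
    Submodule.eq_bot_iff]
  intro u hu
  have hloc : IsLocallyFiniteMeasure μ := isLocallyFiniteMeasure_of_isFiniteMeasureOnCompacts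
  have h := ae_eq_zero_of_integral_contMDiff_smul_eq_zero (𝓡 n) (μ := μ) (f := u)
    ((Lp.memLp u).locallyIntegrable one_le_two) fun g hg hgc => by
      have hz := hu (testToLp μ ⟨g, hg, hgc⟩) ⟨_, rfl⟩
      rw [L2.inner_def] at hz
      rw [← hz]
      refine integral_congr_ae ?_
      filter_upwards [coeFn_testToLp μ ⟨g, hg, hgc⟩] with y hy
      rw [hy]
      simp [mul_comm]
  exact (Lp.eq_zero_iff_ae_eq_zero).2 h

end TestSpace

/-! ### The Dirichlet form extending the energy. -/

section DirichletExtension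

variable {n : ℕ} {G : Type*} [TopologicalSpace G] [ChartedSpace (EuclideanSpace ℝ (Fin n)) G]
  [Group G] [MeasurableSpace G] {X : Module.Basis (Fin n) ℝ (GroupLieAlgebra (𝓡 n) G)} {U : Set G}
  {x : Fin n → G → ℝ} {b : G → Fin n → ℝ} {a : G → Matrix (Fin n) (Fin n) ℝ} {ν : G → Measure G}
  {ρ : Measure G} {lam : G → G → ℝ≥0∞} {f h : G → ℝ}
  {μ : Measure G}

theorem energy_comm (hsymm : IsSymmetricOperator X x b a ν μ) (hf : IsTest (n := n) f)
    (hh : IsTest (n := n) h) : energy X x b a ν μ f h = energy X x b a ν μ h f := by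
  unfold energy
  rw [hsymm f h hf hh]
  simp_rw [mul_comm]

theorem energy_const_mul_right (c : ℝ) :
    energy X x b a ν μ f (fun y => c * h y) = c * energy X x b a ν μ f h := by
  unfold energy
  simp_rw [mul_left_comm _ c]
  rw [integral_const_mul, mul_neg]

theorem IsCharacteristics.diffusion_nonneg (hL : IsCharacteristics U x b a ν ρ lam)
    (f : G → ℝ) (g : G) :
    0 ≤ ∑ i, ∑ j, a g i j * leftDeriv (X i) f g * leftDeriv (X j) f g := by
  have := (hL.posSemidef_a g).dotProduct_mulVec_nonneg fun i => leftDeriv (X i) f g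
  refine this.trans_eq ?_
  simp only [dotProduct, Matrix.mulVec, Pi.star_apply, star_trivial, Finset.mul_sum]
  refine Finset.sum_congr rfl fun i _ => Finset.sum_congr rfl fun j _ => ?_
  ring

variable [LieGroup (𝓡 n) ∞ G] [BorelSpace G] [IsTopologicalGroup G] [SecondCountableTopology G]
  [T2Space G] [μ.IsMulRightInvariant] [IsFiniteMeasureOnCompacts μ] [SFinite μ]

theorem IsCharacteristics.energy_add_right (hL : IsCharacteristics U x b a ν ρ lam)
    (hx : IsCanonicalCoords X U x) {h' : G → ℝ} (hf : IsTest (n := n) f)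
    (hh : IsTest (n := n) h) (hh' : IsTest (n := n) h') :
    energy X x b a ν μ f (fun y => h y + h' y) =
      energy X x b a ν μ f h + energy X x b a ν μ f h' := by
  unfold energy
  simp_rw [mul_add, mul_comm (operator X x b a ν f _)]
  rw [integral_add (hL.integrable_mul_operator hx hh hf) (hL.integrable_mul_operator hx hh' hf),
    neg_add]

variable [LocallyCompactSpace G]

theorem IsCharacteristics.energy_self_nonneg (hL : IsCharacteristics U x b a ν ρ lam)
    (hx : IsCanonicalCoords X U x) (hsymm : IsSymmetricOperator X x b a ν μ)
    (hf : IsTest (n := n) f) : 0 ≤ energy X x b a ν μ f f := by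
  rw [hL.energy_eq hx hsymm hf hf]
  refine add_nonneg (integral_nonneg fun g => hL.diffusion_nonneg f g)
    (mul_nonneg (by norm_num) (integral_nonneg fun g => integral_nonneg fun σ => ?_))
  exact mul_self_nonneg _

/-- In the Beurling–Deny formula the diffusion density picks up the factor φ'(f)² ≤ 1, and
increments shrink because φ is 1-Lipschitz. -/
theorem IsCharacteristics.energy_comp_le (hL : IsCharacteristics U x b a ν ρ lam)
    (hx : IsCanonicalCoords X U x) (hsymm : IsSymmetricOperator X x b a ν μ)
    (hf : IsTest (n := n) f) {φ : ℝ → ℝ} (hφ : ContDiff ℝ ∞ φ) (h0 : φ 0 = 0)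
    (h1 : ∀ t, |deriv φ t| ≤ 1) :
    energy X x b a ν μ (fun y => φ (f y)) (fun y => φ (f y)) ≤ energy X x b a ν μ f f := by
  have hφf := hf.comp hφ h0
  rw [hL.energy_eq hx hsymm hf hf, hL.energy_eq hx hsymm hφf hφf]
  refine add_le_add (integral_mono (hL.integrable_diffusion hφf hφf) (hL.integrable_diffusion hf hf)
    fun g => ?_) (mul_le_mul_of_nonneg_left (integral_mono
      (hL.integrable_integral_increment_mul hx hφf hφf)
      (hL.integrable_integral_increment_mul hx hf hf) fun g => integral_mono
        (hL.integrable_increment_mul hx hφf hφf g) (hL.integrable_increment_mul hx hf hf g)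
        fun σ => ?_) (by norm_num))
  · have e : ∑ i, ∑ j, a g i j * leftDeriv (X i) (fun y => φ (f y)) g *
        leftDeriv (X j) (fun y => φ (f y)) g = deriv φ (f g) ^ 2 *
        ∑ i, ∑ j, a g i j * leftDeriv (X i) f g * leftDeriv (X j) f g := by
      have hφd := hφ.differentiable (by simp) (f g)
      simp_rw [leftDeriv_comp _ hφd (hf.mdiff g), Finset.mul_sum]
      refine Finset.sum_congr rfl fun i _ => Finset.sum_congr rfl fun j _ => ?_
      ring
    simp only
    rw [e]
    refine mul_le_of_le_one_left (hL.diffusion_nonneg f g) ?_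
    rw [← sq_abs]
    exact pow_le_one₀ (abs_nonneg _) (h1 _)
  · have := (lipschitzWith_one_of_abs_deriv_le hφ h1).dist_le_mul (f (g * σ)) (f g)
    rw [Real.dist_eq, Real.dist_eq, NNReal.coe_one, one_mul] at this
    exact abs_le_iff_mul_self_le.1 this

theorem IsCharacteristics.exists_dirichletForm (hL : IsCharacteristics U x b a ν ρ lam)
    (hx : IsCanonicalCoords X U x) (hsymm : IsSymmetricOperator X x b a ν μ) :
    ∃ D : DirichletForm μ, ∀ f₁ f₂ : G → ℝ, IsTest (n := n) f₁ → IsTest (n := n) f₂ →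
      ∃ u₁ u₂ : D.domain, ((u₁ : Lp ℝ 2 μ) : G → ℝ) =ᵐ[μ] f₁ ∧
        ((u₂ : Lp ℝ 2 μ) : G → ℝ) =ᵐ[μ] f₂ ∧ D.form u₁ u₂ = energy X x b a ν μ f₁ f₂ := by
  have hcomm : ∀ u v : testSpace n G, energy X x b a ν μ u v = energy X x b a ν μ v u :=
    fun u v => energy_comm hsymm u.2 v.2
  have hadd : ∀ u v w : testSpace n G, energy X x b a ν μ u (v + w : testSpace n G) =
      energy X x b a ν μ u v + energy X x b a ν μ u w :=
    fun u v w => hL.energy_add_right hx u.2 v.2 w.2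
  have hsmul : ∀ (c : ℝ) (u v : testSpace n G), energy X x b a ν μ u (c • v : testSpace n G) =
      c • energy X x b a ν μ u v := fun c u v => energy_const_mul_right c
  obtain ⟨B, hB⟩ : ∃ B : testSpace n G →ₗ[ℝ] testSpace n G →ₗ[ℝ] ℝ,
      ∀ u v, B u v = energy X x b a ν μ u v :=
    ⟨LinearMap.mk₂ ℝ (fun u v => energy X x b a ν μ u v)
      (fun u v w => by rw [hcomm, hadd, hcomm w u, hcomm w v])
      (fun c u v => by rw [hcomm, hsmul, hcomm v u]) hadd hsmul, fun u v => rfl⟩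
  obtain ⟨D, E, hEs, hEn, hEc, hEB, hcore, hlsc⟩ := exists_closed_extension (testToLp μ) B
    (fun u v => by rw [hB, hB, hcomm])
    (fun u => by rw [hB]; exact hL.energy_self_nonneg hx hsymm u.2)
    -- The operator representing the form is -L, with values in L².
    (fun u => -(hL.memLp_operator hx u.2 μ).toLp _) fun u v => by
      rw [hB, hcomm, inner_neg_left, L2.inner_def]
      unfold energy
      congr 1
      refine integral_congr_ae ?_
      filter_upwards [coeFn_testToLp μ u, (hL.memLp_operator hx v.2 μ).coeFn_toLp] with y h1 h2
      rw [h1, h2]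
      simp [mul_comm]
  obtain ⟨φ, hφ, hφ0, hφ1, hφl⟩ := exists_smooth_unit_contractions
  have hlip := fun k => lipschitzWith_one_of_abs_deriv_le (hφ k) (hφ1 k)
  have hψ0 : min (max (0 : ℝ) 0) 1 = 0 := by norm_num
  have hdense : Dense (D : Set (Lp ℝ 2 μ)) := by
    refine (dense_range_testToLp (n := n) μ).mono ?_
    rintro _ ⟨v, rfl⟩
    obtain ⟨v', -, hv', -⟩ := hEB v v
    rw [← hv']
    exact v'.2
  have hmarkov : ∀ u : D, ∃ v : D,
      ((v : Lp ℝ 2 μ) : G → ℝ) =ᵐ[μ] (fun y => min (max (((u : Lp ℝ 2 μ) : G → ℝ) y) 0) 1) ∧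
        E v v ≤ E u u := by
    intro u
    obtain ⟨s, hs, hsE⟩ := hcore u
    have hlim := tendsto_compLp hlip hφ0 lipschitzWith_unit_contraction hψ0 hφl hs
    let s' : ℕ → testSpace n G := fun k =>
      ⟨fun y => φ k ((s k : G → ℝ) y), (s k).2.comp (hφ k) (hφ0 k)⟩
    have e : ∀ k, (hlip k).compLp (hφ0 k) (testToLp μ (s k)) = testToLp μ (s' k) := fun k => by
      refine Lp.ext ?_
      filter_upwards [(hlip k).coeFn_compLp (hφ0 k) (testToLp μ (s k)), coeFn_testToLp μ (s k),
        coeFn_testToLp μ (s' k)] with y a1 a2 a3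
      rw [a1, a3, Function.comp_apply, a2]
    have hle : ∀ k, B (s' k) (s' k) ≤ B (s k) (s k) := fun k => by
      rw [hB, hB]
      exact hL.energy_comp_le hx hsymm (s k).2 (hφ k) (hφ0 k) (hφ1 k)
    -- The functions φ_k(s_k) converge in L² to the contracted u, with energies at most those of
    -- s_k, which tend to E(u, u); lower semicontinuity concludes.
    obtain ⟨v, hv, hvE⟩ := hlsc s' _ _ _ (hlim.congr e) hle hsE
    refine ⟨v, ?_, hvE⟩
    rw [hv]
    exact lipschitzWith_unit_contraction.coeFn_compLp hψ0 (u : Lp ℝ 2 μ)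
  refine ⟨⟨D, E, hdense, hEs, hEn, hEc, hmarkov⟩, fun f₁ f₂ h₁ h₂ => ?_⟩
  let v₁ : testSpace n G := ⟨f₁, h₁⟩
  let v₂ : testSpace n G := ⟨f₂, h₂⟩
  obtain ⟨u₁, u₂, e₁, e₂, hE⟩ := hEB v₁ v₂
  have a₁ := coeFn_testToLp μ v₁
  have a₂ := coeFn_testToLp μ v₂
  rw [← e₁] at a₁
  rw [← e₂] at a₂
  exact ⟨u₁, u₂, a₁, a₂, hE.trans (hB v₁ v₂)⟩

end DirichletExtension

end

end CourregeHunt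

theorem mainTheorem9 {n : ℕ} {G : Type*} [TopologicalSpace G] [T2Space G]
    [SecondCountableTopology G] [ChartedSpace (EuclideanSpace ℝ (Fin n)) G] [Group G]
    [LieGroup (𝓡 n) ∞ G] [MeasurableSpace G] [BorelSpace G]
    -- a right-invariant Haar measure
    (μ : Measure G) [μ.IsMulRightInvariant] [IsFiniteMeasureOnCompacts μ] [μ.IsOpenPosMeasure]
    -- a basis of the Lie algebra, and canonical coordinates for it
    (X : Module.Basis (Fin n) ℝ (GroupLieAlgebra (𝓡 n) G)) (U : Set G) (x : Fin n → G → ℝ)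
    (hx : CourregeHunt.IsCanonicalCoords X U x)
    -- the characteristics of the operator
    (b : G → Fin n → ℝ) (a : G → Matrix (Fin n) (Fin n) ℝ) (ν : G → Measure G)
    (ρ : Measure G) (lam : G → G → ℝ≥0∞)
    (hL : CourregeHunt.IsCharacteristics U x b a ν ρ lam)
    (hsymm : CourregeHunt.IsSymmetricOperator X x b a ν μ) :
    -- the operator is well defined from test functions to `L²`
    (∀ f : G → ℝ, CourregeHunt.IsTest (n := n) f →
      (∀ g, Integrable (CourregeHunt.compensated X x f g) (ν g)) ∧
        MemLp (CourregeHunt.operator X x b a ν f) 2 μ) ∧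
    -- the form extends to a Dirichlet form
    (∃ D : CourregeHunt.DirichletForm μ, ∀ f₁ f₂ : G → ℝ,
      CourregeHunt.IsTest (n := n) f₁ → CourregeHunt.IsTest (n := n) f₂ →
        ∃ u₁ u₂ : D.domain, ((u₁ : Lp ℝ 2 μ) : G → ℝ) =ᵐ[μ] f₁ ∧
          ((u₂ : Lp ℝ 2 μ) : G → ℝ) =ᵐ[μ] f₂ ∧
          D.form u₁ u₂ = CourregeHunt.energy X x b a ν μ f₁ f₂) ∧
    -- the Beurling-Deny representation
    (∀ f₁ f₂ : G → ℝ, CourregeHunt.IsTest (n := n) f₁ → CourregeHunt.IsTest (n := n) f₂ →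
      Integrable (fun g => ∑ i, ∑ j, a g i j *
        CourregeHunt.leftDeriv (X i) f₁ g * CourregeHunt.leftDeriv (X j) f₂ g) μ ∧
      IntegrableOn (fun p : G × G => (f₁ p.1 - f₁ p.2) * (f₂ p.1 - f₂ p.2))
        {p : G × G | p.1 ≠ p.2} (CourregeHunt.jumpMeasure μ ν) ∧
      CourregeHunt.energy X x b a ν μ f₁ f₂ =
        ∫ g, ∑ i, ∑ j, a g i j *
          CourregeHunt.leftDeriv (X i) f₁ g * CourregeHunt.leftDeriv (X j) f₂ g ∂μ +
        (1 / 2) * ∫ p in {p : G × G | p.1 ≠ p.2},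
          (f₁ p.1 - f₁ p.2) * (f₂ p.1 - f₂ p.2) ∂(CourregeHunt.jumpMeasure μ ν)) := by
  have := topologicalGroup_of_lieGroup (𝓡 n) ∞ (G := G)
  have : LocallyCompactSpace G := Manifold.locallyCompact_of_finiteDimensional (𝓡 n)
  -- With second countability this makes μ σ-finite, as Fubini requires.
  have : IsLocallyFiniteMeasure μ := isLocallyFiniteMeasure_of_isFiniteMeasureOnCompacts
  refine ⟨fun f hf => ⟨hL.integrable_compensated hx hf, hL.memLp_operator hx hf μ⟩,
    hL.exists_dirichletForm hx hsymm, fun f₁ f₂ h₁ h₂ =>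
      ⟨hL.integrable_diffusion h₁ h₂, hL.beurling_deny hx hsymm h₁ h₂⟩⟩
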